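/- Let $A\in\mathbb R^{m\times n}$ be such that $Ax=0$, $x\ge 0$ implies $x=0$ (for instance, all columns of $A$ are nonzero and nonnegative), and let $\gamma>0$, $\lambda>0$, $\rho>0$. Write $\langle\cdot,\cdot\rangle$ and $\|\cdot\|_F$ for the Frobenius inner product and norm, $\|\cdot\|_*$ for the nuclear norm, $\|\cdot\|_1$ for the entrywise $\ell^1$ norm, and for $L,S\in\mathbb R^{m\times n}$, $\mu\in\mathbb R^{n\times n}$ put $$M(L,S,\mu)=\begin{bmatrix} I & L+S-A\\ (L+S-A)^T & \gamma A^TA-\mu\end{bmatrix},\qquad \mathcal G(L,S,\mu)=\begin{bmatrix} 0 & L+S\\ (L+S)^T & -\mu\end{bmatrix}.$$ Consider the cone-preserving decomposition problem: minimize $f(L,S)=\|L\|_*+\lambda\|S\|_1$ over $(Z,L,S,\mu)$ subject to $Z=M(L,S,\mu)$, $Z\succeq 0$ and $\mu\ge 0$ entrywise. Its Lagrangian on $\{Z\succeq0,\ \mu\ge0\}$ is $\mathcal L(Z,L,S,\mu;Y)=f(L,S)+\langle Y,Z-M(L,S,\mu)\rangle$. The linearized ADMM with step size $\tau$ starts from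 $(Z^0,L^0,S^0,\mu^0,Y^0)$ and iterates, for $k\ge0$ (subscripts denote blocks): 1. $Z^{k+1}=Q\Lambda_+Q^T$, where $Q\Lambda Q^T$ is any eigenvalue decomposition of $M(L^k,S^k,\mu^k)-Y^k/\rho$ and $\Lambda_+$ replaces negative eigenvalues by $0$; 2. with $D^k=Z^{k+1}_{12}-L^k-S^k+A+Y^k_{12}/\rho$: $L^{k+1}=U\,\mathcal S_{\tau/\rho}(\Sigma)V^T$, where $U\Sigma V^T$ is any singular value decomposition of $L^k+2\tau D^k$; $S^{k+1}=\mathcal S_{\tau\lambda/\rho}(S^k+2\tau D^k)$ entrywise; and $\mu^{k+1}$ is the entrywise positive part of $\mu^k-\tau(Z^{k+1}_{22}-\gamma A^TA+\mu^k+Y^k_{22}/\rho)$. Here $\mathcal S_\theta(x)=\operatorname{sgn}(x)\max(|x|-\theta,0)$; 3. $Y^{k+1}=Y^k+\rho\,(Z^{k+1}-M(L^{k+1},S^{k+1},\mu^{k+1}))$. **Theorem.** If $m,n\ge1$, then $\mathcal G$ has operator norm $2$ with respect to the norms $(\|L\|_F^2+\|S\|_F^2+\|\mu\|_F^2)^{1/2}$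 and $\|\cdot\|_F$. Suppose $0<\tau<0.25$. Then the iteration can be carried out from every starting point with $\mu^0$ and $Y^0$ symmetric, and every sequence it produces, from any starting point, satisfies the following. (a) $(Z^k,L^k,S^k,\mu^k)$ converges to an optimal solution $(Z^\star,L^\star,S^\star,\mu^\star)$ of the problem. (b) The rate is $O(1/k)$ in the following (ergodic) sense. Let $\bar Z^k,\bar L^k,\bar S^k,\bar\mu^k$ be the averages of the iterates number $1,\dots,k$. There is a constant $C$ such that for all $k\ge1$ $$|f(\bar L^k,\bar S^k)-f(L^\star,S^\star)|\le \frac Ck,\qquad \|\bar Z^k-M(\bar L^k,\bar S^k,\bar\mu^k)\|_F\le\frac Ck .$$ Moreover, with $\hat Y^k=\frac1k\sum_{j=0}^{k-1}\bigl(Y^j+\rho(Z^{j+1}-M(L^j,S^j,\mu^j))\bigr)$, for all $k\ge 1$, all $Z\succeq0$, $L$, $S$, $\mu\ge0$ and $Y$, $$\mathcal L(\bar Z^k,\bar L^k,\bar S^k,\bar\mu^k;Y)-\mathcal L(Z,L,S,\mu;\hat Y^k)\le\frac1{2k}\Bigl(\frac\rho\tau\bigl(\|L-L^0\|_F^2+\|S-S^0\|_F^2+\|\mu-\mu^0\|_F^2\bigr)+\frac1\rho\|Y-Y^0\|_F^2\Bigr).$$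 -/

import Mathlib

open Filter Topology

namespace ConePreserving

noncomputable section

/-- The Frobenius inner product `⟨X, Y⟩ = ∑ᵢⱼ Xᵢⱼ Yᵢⱼ`. -/
def frobInner {p q : Type*} [Fintype p] [Fintype q] (X Y : Matrix p q ℝ) : ℝ :=
  ∑ i, ∑ j, X i j * Y i j

/-- The Frobenius norm. -/
def frobNorm {p q : Type*} [Fintype p] [Fintype q] (X : Matrix p q ℝ) : ℝ :=
  √(∑ i, ∑ j, X i j ^ 2)

/-- The nuclear norm: the sum of all singular values. (Singular values with index `≥ n` vanish.) -/
def nuclearNorm {m n : ℕ} (L : Matrix (Fin m) (Fin n) ℝ) : ℝ :=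
  ∑ i : Fin n, (Matrix.toEuclideanLin L).singularValues i

/-- The entrywise `ℓ¹` norm. -/
def l1Norm {m n : ℕ} (S : Matrix (Fin m) (Fin n) ℝ) : ℝ :=
  ∑ i, ∑ j, |S i j|

/-- The block matrix `[I, L + S - A; (L + S - A)ᵀ, γ AᵀA - μ]`. -/
def blockMat {m n : ℕ} (A : Matrix (Fin m) (Fin n) ℝ) (γ : ℝ)
    (L S : Matrix (Fin m) (Fin n) ℝ) (μ : Matrix (Fin n) (Fin n) ℝ) :
    Matrix (Fin m ⊕ Fin n) (Fin m ⊕ Fin n) ℝ :=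
  Matrix.fromBlocks 1 (L + S - A) (L + S - A).transpose (γ • (A.transpose * A) - μ)

/-- The linear part `𝒢(L, S, μ) = [0, L + S; (L + S)ᵀ, -μ]` of the constraint. -/
def opG {m n : ℕ} (L S : Matrix (Fin m) (Fin n) ℝ) (μ : Matrix (Fin n) (Fin n) ℝ) :
    Matrix (Fin m ⊕ Fin n) (Fin m ⊕ Fin n) ℝ :=
  Matrix.fromBlocks 0 (L + S) (L + S).transpose (-μ)

/-- The finite part `‖L‖_* + lam ‖S‖₁` of the objective. -/
def objective {m n : ℕ} (lam : ℝ) (L S : Matrix (Fin m) (Fin n) ℝ) : ℝ :=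
  nuclearNorm L + lam * l1Norm S

/-- `(Z, L, S, μ)` lies in the domain of the indicator terms and satisfies the linear constraint. -/
def IsFeasible {m n : ℕ} (A : Matrix (Fin m) (Fin n) ℝ) (γ : ℝ)
    (Z : Matrix (Fin m ⊕ Fin n) (Fin m ⊕ Fin n) ℝ)
    (L S : Matrix (Fin m) (Fin n) ℝ) (μ : Matrix (Fin n) (Fin n) ℝ) : Prop :=
  Z.PosSemidef ∧ (∀ i j, 0 ≤ μ i j) ∧ Z - blockMat A γ L S μ = 0

/-- `(Z, L, S, μ)` is an optimal solution of the cone-preserving decomposition problem. -/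
def IsOptimal {m n : ℕ} (A : Matrix (Fin m) (Fin n) ℝ) (γ lam : ℝ)
    (Z : Matrix (Fin m ⊕ Fin n) (Fin m ⊕ Fin n) ℝ)
    (L S : Matrix (Fin m) (Fin n) ℝ) (μ : Matrix (Fin n) (Fin n) ℝ) : Prop :=
  IsFeasible A γ Z L S μ ∧
    ∀ Z' L' S' μ', IsFeasible A γ Z' L' S' μ' → objective lam L S ≤ objective lam L' S'

/-- The (non-augmented) Lagrangian, on the domain `Z ⪰ 0`, `μ ≥ 0` of the indicator terms. -/
def lagrangian {m n : ℕ} (A : Matrix (Fin m) (Fin n) ℝ) (γ lam : ℝ)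
    (Z : Matrix (Fin m ⊕ Fin n) (Fin m ⊕ Fin n) ℝ)
    (L S : Matrix (Fin m) (Fin n) ℝ) (μ : Matrix (Fin n) (Fin n) ℝ)
    (Y : Matrix (Fin m ⊕ Fin n) (Fin m ⊕ Fin n) ℝ) : ℝ :=
  objective lam L S + frobInner Y (Z - blockMat A γ L S μ)

/-- The shrinkage operator `sgn(x) max(|x| - θ, 0)`. -/
def shrink (θ x : ℝ) : ℝ := Real.sign x * max (|x| - θ) 0

/-- `Z = Q Λ₊ Qᵀ` for some eigenvalue decomposition `W = Q Λ Qᵀ`. -/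
def IsPosPart {p : Type*} [Fintype p] [DecidableEq p] (W Z : Matrix p p ℝ) : Prop :=
  ∃ (Q : Matrix p p ℝ) (d : p → ℝ), Q.transpose * Q = 1 ∧
    W = Q * Matrix.diagonal d * Q.transpose ∧
    Z = Q * Matrix.diagonal (fun i => max (d i) 0) * Q.transpose

/-- `D = U 𝒮_θ(Σ) Vᵀ` for some (thin) singular value decomposition `X = U Σ Vᵀ`. -/
def IsSingularThreshold {m n : ℕ} (θ : ℝ) (X D : Matrix (Fin m) (Fin n) ℝ) : Prop :=
  ∃ (r : ℕ) (U : Matrix (Fin m) (Fin r) ℝ) (V : Matrix (Fin n) (Fin r) ℝ) (s : Fin r → ℝ),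
    U.transpose * U = 1 ∧ V.transpose * V = 1 ∧ (∀ i, 0 ≤ s i) ∧
    X = U * Matrix.diagonal s * V.transpose ∧
    D = U * Matrix.diagonal (fun i => shrink θ (s i)) * V.transpose

/-- The common increment `Z₁₂ - L - S + A + Y₁₂ / ρ` of the `L` and `S` updates. -/
def incr {m n : ℕ} (A : Matrix (Fin m) (Fin n) ℝ) (ρ : ℝ)
    (Z : Matrix (Fin m ⊕ Fin n) (Fin m ⊕ Fin n) ℝ) (L S : Matrix (Fin m) (Fin n) ℝ)
    (Y : Matrix (Fin m ⊕ Fin n) (Fin m ⊕ Fin n) ℝ) : Matrix (Fin m) (Fin n) ℝ :=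
  Z.toBlocks₁₂ - L - S + A + ρ⁻¹ • Y.toBlocks₁₂

/-- The sequences are produced by the linearized ADMM iteration with penalty `ρ` and
step size `τ` (the starting point is the value at `0`; any choice of the eigenvalue and
singular value decompositions is allowed in each step). -/
structure IsLADMM {m n : ℕ} (A : Matrix (Fin m) (Fin n) ℝ) (γ lam ρ τ : ℝ)
    (Z : ℕ → Matrix (Fin m ⊕ Fin n) (Fin m ⊕ Fin n) ℝ)
    (L S : ℕ → Matrix (Fin m) (Fin n) ℝ) (μ : ℕ → Matrix (Fin n) (Fin n) ℝ)
    (Y : ℕ → Matrix (Fin m ⊕ Fin n) (Fin m ⊕ Fin n) ℝ) : Prop where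
  stepZ : ∀ k, IsPosPart (blockMat A γ (L k) (S k) (μ k) - ρ⁻¹ • Y k) (Z (k + 1))
  stepL : ∀ k, IsSingularThreshold (τ / ρ)
    (L k + (2 * τ) • incr A ρ (Z (k + 1)) (L k) (S k) (Y k)) (L (k + 1))
  stepS : ∀ k, S (k + 1) =
    (S k + (2 * τ) • incr A ρ (Z (k + 1)) (L k) (S k) (Y k)).map (shrink (τ * lam / ρ))
  stepμ : ∀ k, μ (k + 1) =
    (μ k - τ • ((Z (k + 1)).toBlocks₂₂ - γ • (A.transpose * A) + μ k
      + ρ⁻¹ • (Y k).toBlocks₂₂)).map (fun x => max x 0)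
  stepY : ∀ k, Y (k + 1) =
    Y k + ρ • (Z (k + 1) - blockMat A γ (L (k + 1)) (S (k + 1)) (μ (k + 1)))

/-- The average `(X 1 + ⋯ + X k) / k`. -/
def avg {p q : Type*} (X : ℕ → Matrix p q ℝ) (k : ℕ) : Matrix p q ℝ :=
  (k : ℝ)⁻¹ • ∑ j ∈ Finset.range k, X (j + 1)

/-- The average over `j < k` of the predicted multipliers
`Yʲ + ρ (Zʲ⁺¹ - blockMat (Lʲ, Sʲ, μʲ))`. -/
def avgPredictedY {m n : ℕ} (A : Matrix (Fin m) (Fin n) ℝ) (γ ρ : ℝ)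
    (Z : ℕ → Matrix (Fin m ⊕ Fin n) (Fin m ⊕ Fin n) ℝ)
    (L S : ℕ → Matrix (Fin m) (Fin n) ℝ) (μ : ℕ → Matrix (Fin n) (Fin n) ℝ)
    (Y : ℕ → Matrix (Fin m ⊕ Fin n) (Fin m ⊕ Fin n) ℝ) (k : ℕ) :
    Matrix (Fin m ⊕ Fin n) (Fin m ⊕ Fin n) ℝ :=
  (k : ℝ)⁻¹ • ∑ j ∈ Finset.range k,
    (Y j + ρ • (Z (j + 1) - blockMat A γ (L j) (S j) (μ j)))

end

end ConePreserving

/-!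
Write the problem as the minimization of `φ(v)` over `v ∈ C` subject to `𝒢 v + c ∈ K`. Adding the
variational inequalities of the projection step and of the linearized proximal step shows that, for
every `z ∈ K`, every `u ∈ C` and every multiplier `p`, one iteration lowers the potential
`ρ / (2τ) ‖u - vᵏ‖² + 1 / (2ρ) ‖p - qᵏ‖²` by at least the Lagrangian gap plus `1 - √τ ‖𝒢‖` times the
potential of the increments. Telescoping and convexity give the ergodic rate. At a saddle
point the gap is nonnegative, so the potential is nonincreasing and the increments tend to `0`;
every cluster point is then a saddle point, and monotonicity of its own potential turns
subsequential convergence into convergence. Since `‖𝒢‖ ≤ 2`, the requirement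
`√τ ‖𝒢‖ < 1` follows from `τ < 1 / 4`.

A saddle point exists because the feasible sublevel sets are compact (the nonnegative `μ` is bounded
through `γ AᵀA - μ ⪰ 0`) and a Slater point exists: the condition on `A` makes `γ AᵀA` strictly
copositive, so it is the sum of a matrix with positive definite quadratic form and a nonnegative
matrix.
-/

namespace ConePreserving

noncomputable section

open scoped InnerProductSpace InnerProduct Matrix Matrix.Norms.Frobenius Pointwise

section CesaroMean

variable {V W : Type*} [AddCommGroup V] [Module ℝ V] [AddCommGroup W] [Module ℝ W]

/-- The mean of the first `k` terms of a sequence; it is `0` for `k = 0`. -/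
def cesaroMean (x : ℕ → V) (k : ℕ) : V :=
  (k : ℝ)⁻¹ • ∑ j ∈ Finset.range k, x j

lemma cesaroMean_const {k : ℕ} (hk : k ≠ 0) (c : V) : cesaroMean (fun _ => c) k = c := by
  rw [cesaroMean, Finset.sum_const, Finset.card_range, ← Nat.cast_smul_eq_nsmul ℝ, smul_smul,
    inv_mul_cancel₀ (Nat.cast_ne_zero.2 hk), one_smul]

lemma cesaroMean_add (x x' : ℕ → V) (k : ℕ) :
    cesaroMean (fun j => x j + x' j) k = cesaroMean x k + cesaroMean x' k := by
  simp only [cesaroMean, Finset.sum_add_distrib, smul_add]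

lemma cesaroMean_sub (x x' : ℕ → V) (k : ℕ) :
    cesaroMean (fun j => x j - x' j) k = cesaroMean x k - cesaroMean x' k := by
  simp only [cesaroMean, Finset.sum_sub_distrib, smul_sub]

lemma cesaroMean_const_smul (a : ℝ) (x : ℕ → V) (k : ℕ) :
    cesaroMean (fun j => a • x j) k = a • cesaroMean x k := by
  rw [cesaroMean, cesaroMean, ← Finset.smul_sum, smul_comm]

lemma cesaroMean_increments (x : ℕ → V) (k : ℕ) :
    cesaroMean (fun j => x (j + 1) - x j) k = (k : ℝ)⁻¹ • (x k - x 0) := by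
  rw [cesaroMean, Finset.sum_range_sub]

lemma map_cesaroMean (f : V →ₗ[ℝ] W) (x : ℕ → V) (k : ℕ) :
    f (cesaroMean x k) = cesaroMean (fun j => f (x j)) k := by
  rw [cesaroMean, map_smul, map_sum, cesaroMean]

lemma cesaroMean_toLp_mk (x : ℕ → V) (y : ℕ → W) (k : ℕ) :
    cesaroMean (fun j => WithLp.toLp 2 (x j, y j)) k
      = WithLp.toLp 2 (cesaroMean x k, cesaroMean y k) := by
  simp only [cesaroMean, ← WithLp.toLp_smul, ← WithLp.toLp_sum, ← Prod.smul_mk, prod_mk_sum]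

lemma cesaroMean_mono {a b : ℕ → ℝ} (hab : ∀ j, a j ≤ b j) (k : ℕ) :
    cesaroMean a k ≤ cesaroMean b k :=
  mul_le_mul_of_nonneg_left (Finset.sum_le_sum fun j _ => hab j) (by positivity)

lemma cesaroMean_mem {C : Set V} (hC : Convex ℝ C) {x : ℕ → V} (hx : ∀ j, x j ∈ C) {k : ℕ}
    (hk : k ≠ 0) : cesaroMean x k ∈ C := by
  rw [cesaroMean, Finset.smul_sum]
  exact hC.sum_mem (fun _ _ => by positivity) (by simp [hk]) fun j _ => hx j

lemma map_cesaroMean_le {C : Set V} {φ : V → ℝ} (hφ : ConvexOn ℝ C φ) {x : ℕ → V}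
    (hx : ∀ j, x j ∈ C) {k : ℕ} (hk : k ≠ 0) :
    φ (cesaroMean x k) ≤ cesaroMean (fun j => φ (x j)) k := by
  simpa only [cesaroMean, Finset.smul_sum] using
    hφ.map_sum_le (t := Finset.range k) (w := fun _ => (k : ℝ)⁻¹) (p := x)
      (fun _ _ => by positivity) (by simp [hk]) (fun j _ => hx j)

end CesaroMean

section ProxPoint

variable {V W : Type*} [NormedAddCommGroup V] [InnerProductSpace ℝ V]
  [NormedAddCommGroup W] [InnerProductSpace ℝ W]

/-- `x` is the proximal point of `w` for the convex function `f` on the convex set `C`, that is,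
the minimizer of `f v + ‖v - w‖² / 2` over `v ∈ C`. It is encoded by the variational inequality
which characterizes this minimizer. -/
structure IsProxPoint (C : Set V) (f : V → ℝ) (w x : V) : Prop where
  mem : x ∈ C
  le : ∀ v ∈ C, f x + ⟪w - x, v - x⟫_ℝ ≤ f v

lemma IsProxPoint.prod {C : Set V} {D : Set W} {f : V → ℝ} {g : W → ℝ} {w x : V} {w' x' : W}
    (hf : IsProxPoint C f w x) (hg : IsProxPoint D g w' x') :
    IsProxPoint {u : WithLp 2 (V × W) | u.fst ∈ C ∧ u.snd ∈ D} (fun u => f u.fst + g u.snd)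
      (WithLp.toLp 2 (w, w')) (WithLp.toLp 2 (x, x')) where
  mem := ⟨hf.mem, hg.mem⟩
  le v hv := by
    calc f x + g x' + ⟪WithLp.toLp 2 (w, w') - WithLp.toLp 2 (x, x'),
          v - WithLp.toLp 2 (x, x')⟫_ℝ
        = (f x + ⟪w - x, v.fst - x⟫_ℝ) + (g x' + ⟪w' - x', v.snd - x'⟫_ℝ) := by
          rw [WithLp.prod_inner_apply]
          exact add_add_add_comm _ _ _ _
      _ ≤ f v.fst + g v.snd := add_le_add (hf.le _ hv.1) (hg.le _ hv.2)

end ProxPoint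

section Potential

variable {E F : Type*} [NormedAddCommGroup E] [NormedAddCommGroup F] {ρ τ : ℝ}

/-- The weighted squared norm of a primal-dual pair; evaluated at the difference between a saddle
point and the current iterate, it is the Lyapunov function of the linearized ADMM. -/
def potential (ρ τ : ℝ) (u : F) (p : E) : ℝ :=
  ρ / (2 * τ) * ‖u‖ ^ 2 + 1 / (2 * ρ) * ‖p‖ ^ 2

lemma potential_nonneg (hρ : 0 < ρ) (hτ : 0 < τ) (u : F) (p : E) : 0 ≤ potential ρ τ u p := by
  unfold potential
  positivity

lemma continuous_potential (ρ τ : ℝ) : Continuous fun x : F × E => potential ρ τ x.1 x.2 := by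
  unfold potential
  fun_prop

lemma norm_mul_norm_le_potential (hρ : 0 < ρ) (hτ : 0 < τ) (u : F) (p : E) :
    ‖u‖ * ‖p‖ ≤ √τ * potential ρ τ u p := by
  have : 0 < √τ := Real.sqrt_pos.2 hτ
  have hcomplete_square :
      √τ * potential ρ τ u p - ‖u‖ * ‖p‖ = (ρ * ‖u‖ - √τ * ‖p‖) ^ 2 / (2 * ρ * √τ) := by
    unfold potential
    nth_rw 2 [← Real.sq_sqrt hτ.le]
    field_simp
    ring
  exact sub_nonneg.1 (hcomplete_square ▸ by positivity)

lemma norm_left_le_of_potential_le (hρ : 0 < ρ) (hτ : 0 < τ) {u : F} {p : E} {B : ℝ}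
    (hB : potential ρ τ u p ≤ B) : ‖u‖ ≤ √(2 * τ / ρ * B) := by
  refine Real.le_sqrt_of_sq_le ?_
  calc ‖u‖ ^ 2 = 2 * τ / ρ * (ρ / (2 * τ) * ‖u‖ ^ 2) := by field_simp
    _ ≤ 2 * τ / ρ * B := by
      gcongr
      exact (le_add_of_nonneg_right (by positivity)).trans hB

lemma norm_right_le_of_potential_le (hρ : 0 < ρ) (hτ : 0 < τ) {u : F} {p : E} {B : ℝ}
    (hB : potential ρ τ u p ≤ B) : ‖p‖ ≤ √(2 * ρ * B) := by
  refine Real.le_sqrt_of_sq_le ?_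
  calc ‖p‖ ^ 2 = 2 * ρ * (1 / (2 * ρ) * ‖p‖ ^ 2) := by field_simp
    _ ≤ 2 * ρ * B := by
      gcongr
      exact (le_add_of_nonneg_left (by positivity)).trans hB

lemma tendsto_zero_of_potential (hρ : 0 < ρ) (hτ : 0 < τ) {u : ℕ → F} {p : ℕ → E}
    (h : Tendsto (fun k => potential ρ τ (u k) (p k)) atTop (𝓝 0)) :
    Tendsto u atTop (𝓝 0) ∧ Tendsto p atTop (𝓝 0) := by
  have hsqrt (r : ℝ) : Tendsto (fun k => √(r * potential ρ τ (u k) (p k))) atTop (𝓝 0) := by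
    simpa using (h.const_mul r).sqrt
  exact ⟨squeeze_zero_norm (fun k => norm_left_le_of_potential_le hρ hτ le_rfl) (hsqrt _),
    squeeze_zero_norm (fun k => norm_right_le_of_potential_le hρ hτ le_rfl) (hsqrt _)⟩

end Potential

section PotentialExpansion

variable {E F : Type*} [NormedAddCommGroup E] [InnerProductSpace ℝ E] [NormedAddCommGroup F]
  [InnerProductSpace ℝ F] {ρ τ : ℝ}

lemma potential_add (hρ : ρ ≠ 0) (hτ : τ ≠ 0) (u a : F) (p b : E) :
    potential ρ τ (u + a) (p + b) = potential ρ τ u p + potential ρ τ a b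
      + ρ / τ * ⟪a, u⟫_ℝ + ρ⁻¹ * ⟪p, b⟫_ℝ := by
  unfold potential
  rw [norm_add_sq_real, norm_add_sq_real, real_inner_comm u a]
  field_simp
  ring

end PotentialExpansion

section LinearizedADMM

/-- The data of the problem of minimizing `φ v` over `v ∈ C` subject to `G v + c ∈ K`, which is
split into the constraints `z ∈ K` and `z = G v + c`. -/
structure SplitProgram (E F : Type*) [NormedAddCommGroup E] [InnerProductSpace ℝ E]
    [NormedAddCommGroup F] [InnerProductSpace ℝ F] where
  K : Set E
  C : Set F
  φ : F → ℝ
  G : F →L[ℝ] E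
  c : E

variable {E F : Type*} [NormedAddCommGroup E] [InnerProductSpace ℝ E]
  [NormedAddCommGroup F] [InnerProductSpace ℝ F]

namespace SplitProgram

variable (P : SplitProgram E F)

/-- The violation of the coupling constraint `z = G v + c`. -/
def residual (z : E) (v : F) : E := z - P.G v - P.c

/-- The Lagrangian of the split problem, with multiplier `q`. -/
def lagrangian (z : E) (v : F) (q : E) : ℝ := P.φ v + ⟪q, P.residual z v⟫_ℝ

/-- The multiplier after a dual ascent step with penalty `ρ` at `(z, v)`. -/
def dualStep (ρ : ℝ) (z : E) (v : F) (q : E) : E := q + ρ • P.residual z v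

/-- `(G v + c, v)` and `q` form a saddle point of the Lagrangian. The maximality in the multiplier
is automatic because the residual vanishes. -/
structure IsSaddle (v : F) (q : E) : Prop where
  mem_C : v ∈ P.C
  mem_K : P.G v + P.c ∈ P.K
  le_lagrangian : ∀ z ∈ P.K, ∀ u ∈ P.C, P.φ v ≤ P.lagrangian z u q

lemma residual_map_add (v : F) : P.residual (P.G v + P.c) v = 0 := by
  rw [residual, add_sub_cancel_left, sub_self]

lemma residual_add_map_add (z : E) (v : F) : P.residual z v + (P.G v + P.c) = z := by
  rw [residual, sub_sub, sub_add_cancel]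

lemma tendsto_of_tendsto_residual {ι : Type*} {l : Filter ι} {z : ι → E} {v : ι → F} {u : F}
    (hres : Tendsto (fun k => P.residual (z k) (v k)) l (𝓝 0)) (hv : Tendsto v l (𝓝 u)) :
    Tendsto z l (𝓝 (P.G u + P.c)) := by
  simpa only [Function.comp_apply, residual_add_map_add, zero_add] using
    hres.add (((P.G.continuous.tendsto u).comp hv).add_const P.c)

lemma lagrangian_map_add (v : F) (q : E) : P.lagrangian (P.G v + P.c) v q = P.φ v := by
  rw [lagrangian, residual_map_add, inner_zero_right, add_zero]

lemma cesaroMean_residual (z : ℕ → E) (v : ℕ → F) {k : ℕ} (hk : k ≠ 0) :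
    cesaroMean (fun j => P.residual (z j) (v j)) k
      = P.residual (cesaroMean z k) (cesaroMean v k) := by
  simp only [residual, cesaroMean_sub, cesaroMean_const hk]
  congr 2
  exact (map_cesaroMean P.G.toLinearMap v k).symm

lemma cesaroMean_inner_residual (z : ℕ → E) (v : ℕ → F) (q : E) {k : ℕ} (hk : k ≠ 0) :
    cesaroMean (fun j => ⟪q, P.residual (z j) (v j)⟫_ℝ) k
      = ⟪q, P.residual (cesaroMean z k) (cesaroMean v k)⟫_ℝ := by
  rw [← P.cesaroMean_residual z v hk]
  exact (map_cesaroMean (innerₛₗ ℝ q) _ k).symm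

lemma lagrangian_cesaroMean_le (hφ : ConvexOn ℝ P.C P.φ) (z : ℕ → E) {v : ℕ → F}
    (hv : ∀ j, v j ∈ P.C) (q : E) {k : ℕ} (hk : k ≠ 0) :
    P.lagrangian (cesaroMean z k) (cesaroMean v k) q
      ≤ cesaroMean (fun j => P.lagrangian (z j) (v j) q) k := by
  simp only [lagrangian, cesaroMean_add, P.cesaroMean_inner_residual z v q hk]
  gcongr
  exact map_cesaroMean_le hφ hv hk

lemma cesaroMean_lagrangian_multiplier (z : E) (v : F) (q : ℕ → E) {k : ℕ} (hk : k ≠ 0) :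
    cesaroMean (fun j => P.lagrangian z v (q j)) k = P.lagrangian z v (cesaroMean q k) := by
  simp only [lagrangian, cesaroMean_add, cesaroMean_const hk, real_inner_comm (P.residual z v)]
  congr 1
  exact (map_cesaroMean (innerₛₗ ℝ (P.residual z v)) q k).symm

/-- The points `(y, t)` for which some `v ∈ C` satisfies `y + G v + c ∈ O` and `φ v < t`: the strict
epigraph of the value function of the perturbed constraint `y + G v + c ∈ O`. -/
def strictEpigraph (O : Set E) : Set (E × ℝ) :=
  {x | ∃ v ∈ P.C, x.1 + P.G v + P.c ∈ O ∧ P.φ v < x.2}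

lemma isOpen_strictEpigraph {O : Set E} (hO : IsOpen O) : IsOpen (P.strictEpigraph O) := by
  have hunion : P.strictEpigraph O
      = ⋃ v ∈ P.C, {x : E × ℝ | x.1 + P.G v + P.c ∈ O} ∩ {x | P.φ v < x.2} := by
    ext x
    simp [strictEpigraph, and_left_comm]
  rw [hunion]
  exact isOpen_biUnion fun v _ => (hO.preimage (by fun_prop)).inter
    (isOpen_lt continuous_const continuous_snd)

lemma convex_strictEpigraph {O : Set E} (hO : Convex ℝ O) (hφ : ConvexOn ℝ P.C P.φ) :
    Convex ℝ (P.strictEpigraph O) := by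
  rintro ⟨y, t⟩ ⟨v, hv, hvO, hvt⟩ ⟨y', t'⟩ ⟨v', hv', hvO', hvt'⟩ a b ha hb hab
  refine ⟨a • v + b • v', hφ.1 hv hv' ha hb hab, ?_, ?_⟩
  · have hcomb : a • y + b • y' + P.G (a • v + b • v') + P.c
        = a • (y + P.G v + P.c) + b • (y' + P.G v' + P.c) := by
      nth_rw 1 [← one_smul ℝ P.c, ← hab]
      simp only [map_add, map_smul]
      module
    exact hcomb ▸ hO hvO hvO' ha hb hab
  · have hlt : a • (P.φ v - t) + b • (P.φ v' - t') < 0 :=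
      convex_Iio (0 : ℝ) (sub_neg.2 hvt) (sub_neg.2 hvt') ha hb hab
    refine (hφ.2 hv hv' ha hb hab).trans_lt (sub_neg.1 (hlt.trans_eq' ?_))
    simp only [smul_eq_mul, Prod.snd_add, Prod.smul_snd]
    ring

/-- Slater's theorem: a hyperplane separating the strict epigraph of the value function from the
point `(0, r)` is not vertical, since a strictly feasible point exists. -/
theorem exists_multiplier [CompleteSpace E] {O : Set E} (hO : IsOpen O) (hOconv : Convex ℝ O)
    (hφ : ConvexOn ℝ P.C P.φ) {r : ℝ} (hr : ∀ v ∈ P.C, P.G v + P.c ∈ O → r ≤ P.φ v)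
    {v₀ : F} (hv₀ : v₀ ∈ P.C) (hv₀O : P.G v₀ + P.c ∈ O) :
    ∃ q : E, ∀ z ∈ closure O, ∀ v ∈ P.C, r ≤ P.lagrangian z v q := by
  have hnot : ((0 : E), r) ∉ P.strictEpigraph O := by
    rintro ⟨v, hv, hvO, hvr⟩
    rw [zero_add] at hvO
    exact (hr v hv hvO).not_gt hvr
  obtain ⟨f, hf⟩ := geometric_hahn_banach_point_open (P.convex_strictEpigraph hOconv hφ)
    (P.isOpen_strictEpigraph hO) hnot
  set s := f (0, 1) with hs
  have hsplit (y : E) (t : ℝ) : f (y, t) = f (y, 0) + t * s := by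
    rw [hs, ← smul_eq_mul, ← map_smul, ← map_add]
    simp
  have hs_pos : 0 < s := by
    have hmem : ((0 : E), max r (P.φ v₀) + 1) ∈ P.strictEpigraph O :=
      ⟨v₀, hv₀, by rwa [zero_add], (le_max_right _ _).trans_lt (lt_add_one _)⟩
    have hlt := hf _ hmem
    rw [hsplit 0 r, hsplit 0 (max r _ + 1), add_lt_add_iff_left] at hlt
    nlinarith [le_max_left r (P.φ v₀)]
  set g : StrongDual ℝ E := s⁻¹ • f.comp (ContinuousLinearMap.inl ℝ E ℝ)
  have hg (y : E) {t : ℝ} (hyt : (y, t) ∈ P.strictEpigraph O) : r ≤ g y + t := by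
    have hlt := hf _ hyt
    rw [hsplit 0 r, hsplit y t, show ((0 : E), (0 : ℝ)) = 0 from rfl, map_zero, zero_add] at hlt
    calc r = s⁻¹ * (r * s) := by field_simp
      _ ≤ s⁻¹ * (f (y, 0) + t * s) := by gcongr
      _ = g y + t := by
        rw [mul_add, mul_left_comm, inv_mul_cancel₀ hs_pos.ne', mul_one]
        rfl
  refine ⟨(InnerProductSpace.toDual ℝ E).symm g, fun z hz v hv => ?_⟩
  refine closure_minimal (t := {z | r ≤ P.lagrangian z v _}) (fun z hz => ?_)
    (isClosed_le continuous_const ?_) hz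
  · rw [Set.mem_ofPred_eq, lagrangian, InnerProductSpace.toDual_symm_apply, add_comm]
    refine le_of_forall_pos_le_add fun ε hε => ?_
    rw [add_assoc]
    refine hg _ ⟨v, hv, ?_, lt_add_of_pos_right _ hε⟩
    rwa [add_assoc, residual_add_map_add]
  · unfold lagrangian residual
    fun_prop

end SplitProgram

variable [CompleteSpace E] [CompleteSpace F]

/-- The sequences are produced by the linearized ADMM with penalty `ρ` and step size `τ`: an exact
minimization of the augmented Lagrangian in `z`, a proximal gradient step in `v`, and a dual
ascent step. -/
structure IsLinearizedADMM (P : SplitProgram E F) (ρ τ : ℝ) (z : ℕ → E) (v : ℕ → F)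
    (q : ℕ → E) : Prop where
  proj : ∀ k, IsProxPoint P.K 0 (P.G (v k) + P.c - ρ⁻¹ • q k) (z (k + 1))
  prox : ∀ k, IsProxPoint P.C ((τ / ρ) • P.φ)
    (v k + (τ / ρ) • (P.G†) (P.dualStep ρ (z (k + 1)) (v k) (q k))) (v (k + 1))
  dual : ∀ k, q (k + 1) = P.dualStep ρ (z (k + 1)) (v (k + 1)) (q k)

namespace IsLinearizedADMM

variable {P : SplitProgram E F} {ρ τ : ℝ} {z : ℕ → E} {v : ℕ → F} {q : ℕ → E}

lemma residual_succ (h : IsLinearizedADMM P ρ τ z v q) (hρ : ρ ≠ 0) (k : ℕ) :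
    P.residual (z (k + 1)) (v (k + 1)) = ρ⁻¹ • (q (k + 1) - q k) := by
  rw [h.dual k, SplitProgram.dualStep, add_sub_cancel_left, inv_smul_smul₀ hρ]

lemma dualStep_eq (h : IsLinearizedADMM P ρ τ z v q) (k : ℕ) :
    P.dualStep ρ (z (k + 1)) (v k) (q k) = q (k + 1) + ρ • P.G (v (k + 1) - v k) := by
  rw [h.dual k, SplitProgram.dualStep, SplitProgram.dualStep, add_assoc, ← smul_add,
    SplitProgram.residual, SplitProgram.residual, map_sub]
  congr 2
  abel

lemma inner_dualStep_nonneg (h : IsLinearizedADMM P ρ τ z v q) (hρ : 0 < ρ) (k : ℕ) {w : E}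
    (hw : w ∈ P.K) : 0 ≤ ⟪P.dualStep ρ (z (k + 1)) (v k) (q k), w - z (k + 1)⟫_ℝ := by
  have hdual : P.dualStep ρ (z (k + 1)) (v k) (q k)
      = -ρ • (P.G (v k) + P.c - ρ⁻¹ • q k - z (k + 1)) := by
    rw [SplitProgram.dualStep, SplitProgram.residual, neg_smul, ← smul_neg, ← sub_eq_zero]
    nth_rw 1 [← smul_inv_smul₀ hρ.ne' (q k)]
    rw [← smul_add, ← smul_sub, smul_eq_zero]
    right
    abel
  have hproj := (h.proj k).le w hw
  rw [Pi.zero_apply, Pi.zero_apply, zero_add] at hproj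
  rw [hdual, real_inner_smul_left]
  exact mul_nonneg_of_nonpos_of_nonpos (neg_nonpos.2 hρ.le) hproj

lemma prox_le (h : IsLinearizedADMM P ρ τ z v q) (hρ : 0 < ρ) (hτ : 0 < τ) (k : ℕ) {u : F}
    (hu : u ∈ P.C) : P.φ (v (k + 1)) + ρ / τ * ⟪v k - v (k + 1), u - v (k + 1)⟫_ℝ
      + ⟪P.dualStep ρ (z (k + 1)) (v k) (q k), P.G (u - v (k + 1))⟫_ℝ ≤ P.φ u := by
  have hprox := (h.prox k).le u hu
  rw [add_sub_right_comm, inner_add_left, real_inner_smul_left,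
    ContinuousLinearMap.adjoint_inner_left, Pi.smul_apply, Pi.smul_apply, smul_eq_mul,
    smul_eq_mul] at hprox
  refine le_of_mul_le_mul_left (le_of_eq_of_le ?_ hprox) (div_pos hτ hρ)
  field_simp
  ring

lemma gap_le (h : IsLinearizedADMM P ρ τ z v q) (hρ : 0 < ρ) (hτ : 0 < τ) (k : ℕ) {w : E}
    (hw : w ∈ P.K) {u : F} (hu : u ∈ P.C) (p : E) :
    P.lagrangian (z (k + 1)) (v (k + 1)) p
      - P.lagrangian w u (P.dualStep ρ (z (k + 1)) (v k) (q k))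
    ≤ -(ρ / τ * ⟪v k - v (k + 1), u - v (k + 1)⟫_ℝ)
      + ⟪p - P.dualStep ρ (z (k + 1)) (v k) (q k), P.residual (z (k + 1)) (v (k + 1))⟫_ℝ := by
  have hproj := h.inner_dualStep_nonneg hρ k hw
  have hprox := h.prox_le hρ hτ k hu
  simp only [SplitProgram.lagrangian, SplitProgram.residual, map_sub, inner_sub_right,
    inner_sub_left] at *
  linarith

/-- The linearization error `⟪G (vₖ₊₁ - vₖ), qₖ₊₁ - qₖ⟫` is absorbed by the potential of the
increments. -/
lemma gap_add_potential_le (h : IsLinearizedADMM P ρ τ z v q) (hρ : 0 < ρ) (hτ : 0 < τ) (k : ℕ)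
    {w : E} (hw : w ∈ P.K) {u : F} (hu : u ∈ P.C) (p : E) :
    P.lagrangian (z (k + 1)) (v (k + 1)) p
      - P.lagrangian w u (P.dualStep ρ (z (k + 1)) (v k) (q k))
      + potential ρ τ (u - v (k + 1)) (p - q (k + 1))
      + (1 - √τ * ‖P.G‖) * potential ρ τ (v (k + 1) - v k) (q (k + 1) - q k)
    ≤ potential ρ τ (u - v k) (p - q k) := by
  have hgap := h.gap_le hρ hτ k hw hu p
  rw [h.residual_succ hρ.ne' k, h.dualStep_eq k] at hgap
  rw [h.dualStep_eq k, ← sub_add_sub_cancel u (v (k + 1)) (v k),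
    ← sub_add_sub_cancel p (q (k + 1)) (q k), potential_add hρ.ne' hτ.ne']
  rw [← sub_sub, ← neg_sub (v (k + 1)) (v k)] at hgap
  generalize v (k + 1) - v k = a at *
  generalize q (k + 1) - q k = b at *
  have herror : -⟪P.G a, b⟫_ℝ ≤ √τ * ‖P.G‖ * potential ρ τ a b := by
    calc -⟪P.G a, b⟫_ℝ ≤ ‖P.G a‖ * ‖b‖ := (neg_le_abs _).trans (abs_real_inner_le_norm _ _)
      _ ≤ ‖P.G‖ * ‖a‖ * ‖b‖ := by gcongr; exact P.G.le_opNorm a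
      _ = ‖P.G‖ * (‖a‖ * ‖b‖) := mul_assoc _ _ _
      _ ≤ ‖P.G‖ * (√τ * potential ρ τ a b) :=
        mul_le_mul_of_nonneg_left (norm_mul_norm_le_potential hρ hτ a b) (norm_nonneg _)
      _ = √τ * ‖P.G‖ * potential ρ τ a b := by ring
  simp only [inner_neg_left, inner_sub_left (_ - q (k + 1)), real_inner_smul_left,
    real_inner_smul_right] at hgap
  linarith [mul_inv_cancel_left₀ hρ.ne' ⟪P.G a, b⟫_ℝ]

section Convergence

variable {u : F} {p : E}

lemma potential_succ_le (h : IsLinearizedADMM P ρ τ z v q) (hρ : 0 < ρ) (hτ : 0 < τ)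
    (hs : P.IsSaddle u p) (k : ℕ) :
    potential ρ τ (u - v (k + 1)) (p - q (k + 1))
      + (1 - √τ * ‖P.G‖) * potential ρ τ (v (k + 1) - v k) (q (k + 1) - q k)
    ≤ potential ρ τ (u - v k) (p - q k) := by
  have hgap := h.gap_add_potential_le hρ hτ k hs.mem_K hs.mem_C p
  have hsaddle := hs.le_lagrangian _ (h.proj k).mem _ (h.prox k).mem
  rw [P.lagrangian_map_add] at hgap
  linarith

lemma potential_antitone (h : IsLinearizedADMM P ρ τ z v q) (hρ : 0 < ρ) (hτ : 0 < τ)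
    (hstep : √τ * ‖P.G‖ ≤ 1) (hs : P.IsSaddle u p) :
    Antitone fun k => potential ρ τ (u - v k) (p - q k) :=
  antitone_nat_of_succ_le fun k => (le_add_of_nonneg_right
    (mul_nonneg (sub_nonneg.2 hstep) (potential_nonneg hρ hτ _ _))).trans
      (h.potential_succ_le hρ hτ hs k)

lemma tendsto_increments (h : IsLinearizedADMM P ρ τ z v q) (hρ : 0 < ρ) (hτ : 0 < τ)
    (hstep : √τ * ‖P.G‖ < 1) (hs : P.IsSaddle u p) :
    Tendsto (fun k => v (k + 1) - v k) atTop (𝓝 0) ∧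
      Tendsto (fun k => q (k + 1) - q k) atTop (𝓝 0) := by
  apply tendsto_zero_of_potential hρ hτ
  have hlim := tendsto_atTop_ciInf (h.potential_antitone hρ hτ hstep.le hs)
    ⟨0, by rintro _ ⟨k, rfl⟩; exact potential_nonneg hρ hτ _ _⟩
  have hdiff := (hlim.sub (hlim.comp (tendsto_add_atTop_nat 1))).const_mul (1 - √τ * ‖P.G‖)⁻¹
  rw [sub_self, mul_zero] at hdiff
  refine squeeze_zero (fun k => potential_nonneg hρ hτ _ _) (fun k => ?_) hdiff
  rw [inv_mul_eq_div, le_div_iff₀' (sub_pos.2 hstep)]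
  exact le_sub_iff_add_le'.2 (h.potential_succ_le hρ hτ hs k)

lemma norm_sub_multiplier_le (h : IsLinearizedADMM P ρ τ z v q) (hρ : 0 < ρ) (hτ : 0 < τ)
    (hstep : √τ * ‖P.G‖ ≤ 1) (hs : P.IsSaddle u p) (k : ℕ) :
    ‖p - q k‖ ≤ √(2 * ρ * potential ρ τ (u - v 0) (p - q 0)) :=
  norm_right_le_of_potential_le hρ hτ (h.potential_antitone hρ hτ hstep hs (Nat.zero_le k))

lemma norm_sub_primal_le (h : IsLinearizedADMM P ρ τ z v q) (hρ : 0 < ρ) (hτ : 0 < τ)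
    (hstep : √τ * ‖P.G‖ ≤ 1) (hs : P.IsSaddle u p) (k : ℕ) :
    ‖u - v k‖ ≤ √(2 * τ / ρ * potential ρ τ (u - v 0) (p - q 0)) :=
  norm_left_le_of_potential_le hρ hτ (h.potential_antitone hρ hτ hstep hs (Nat.zero_le k))

lemma isBounded_range (h : IsLinearizedADMM P ρ τ z v q) (hρ : 0 < ρ) (hτ : 0 < τ)
    (hstep : √τ * ‖P.G‖ ≤ 1) (hs : P.IsSaddle u p) :
    Bornology.IsBounded (Set.range fun k => (v k, q k)) := by
  set B := potential ρ τ (u - v 0) (p - q 0)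
  have hball : Bornology.IsBounded (Metric.closedBall u √(2 * τ / ρ * B) ×ˢ
      Metric.closedBall p √(2 * ρ * B)) :=
    Metric.isBounded_closedBall.prod Metric.isBounded_closedBall
  refine hball.subset (Set.range_subset_iff.2 fun k => ⟨?_, ?_⟩)
  · exact (dist_eq_norm_sub' _ _).trans_le (h.norm_sub_primal_le hρ hτ hstep hs k)
  · exact (dist_eq_norm_sub' _ _).trans_le (h.norm_sub_multiplier_le hρ hτ hstep hs k)

lemma tendsto_residual (h : IsLinearizedADMM P ρ τ z v q) (hρ : ρ ≠ 0)
    (hdq : Tendsto (fun k => q (k + 1) - q k) atTop (𝓝 0)) :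
    Tendsto (fun k => P.residual (z (k + 1)) (v (k + 1))) atTop (𝓝 0) := by
  simpa only [h.residual_succ hρ, smul_zero] using hdq.const_smul ρ⁻¹

lemma tendsto_dualStep (h : IsLinearizedADMM P ρ τ z v q) {ι : Type*} {l : Filter ι} {θ : ι → ℕ}
    (hdv : Tendsto (fun i => v (θ i + 1) - v (θ i)) l (𝓝 0))
    (hq : Tendsto (fun i => q (θ i + 1)) l (𝓝 p)) :
    Tendsto (fun i => P.dualStep ρ (z (θ i + 1)) (v (θ i)) (q (θ i))) l (𝓝 p) := by
  simp only [h.dualStep_eq]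
  simpa using hq.add (((P.G.continuous.tendsto 0).comp hdv).const_smul ρ)

/-- Passing to the limit in `gap_le`, whose right-hand side vanishes with the increments. -/
lemma isSaddle_of_tendsto_subseq (h : IsLinearizedADMM P ρ τ z v q) (hρ : 0 < ρ) (hτ : 0 < τ)
    (hK : IsClosed P.K) (hC : IsClosed P.C) (hφ : ContinuousOn P.φ P.C)
    (hdv : Tendsto (fun k => v (k + 1) - v k) atTop (𝓝 0))
    (hdq : Tendsto (fun k => q (k + 1) - q k) atTop (𝓝 0))
    {θ : ℕ → ℕ} (hθ : Tendsto θ atTop atTop)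
    (hv : Tendsto (fun k => v (θ k)) atTop (𝓝 u)) (hq : Tendsto (fun k => q (θ k)) atTop (𝓝 p)) :
    P.IsSaddle u p := by
  have hv' : Tendsto (fun k => v (θ k + 1)) atTop (𝓝 u) := by
    simpa using (hdv.comp hθ).add hv
  have hq' : Tendsto (fun k => q (θ k + 1)) atTop (𝓝 p) := by
    simpa using (hdq.comp hθ).add hq
  have hres := (h.tendsto_residual hρ.ne' hdq).comp hθ
  have hz : Tendsto (fun k => z (θ k + 1)) atTop (𝓝 (P.G u + P.c)) :=
    P.tendsto_of_tendsto_residual hres hv'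
  have hpred : Tendsto (fun k => P.dualStep ρ (z (θ k + 1)) (v (θ k)) (q (θ k))) atTop (𝓝 p) :=
    h.tendsto_dualStep (hdv.comp hθ) hq'
  have hu : u ∈ P.C := hC.mem_of_tendsto hv' (Eventually.of_forall fun k => (h.prox _).mem)
  have hφ' : Tendsto (fun k => P.φ (v (θ k + 1))) atTop (𝓝 (P.φ u)) :=
    (hφ u hu).tendsto.comp (tendsto_nhdsWithin_iff.2
      ⟨hv', Eventually.of_forall fun k => (h.prox _).mem⟩)
  refine ⟨hu, hK.mem_of_tendsto hz (Eventually.of_forall fun k => (h.proj _).mem),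
    fun w hw x hx => ?_⟩
  have hleft : Tendsto (fun k => P.lagrangian (z (θ k + 1)) (v (θ k + 1)) p
      - P.lagrangian w x (P.dualStep ρ (z (θ k + 1)) (v (θ k)) (q (θ k)))) atTop
      (𝓝 (P.φ u + ⟪p, (0 : E)⟫_ℝ - P.lagrangian w x p)) :=
    (hφ'.add (tendsto_const_nhds.inner hres)).sub
      (tendsto_const_nhds.add (hpred.inner tendsto_const_nhds))
  have hright : Tendsto (fun k => -(ρ / τ * ⟪v (θ k) - v (θ k + 1), x - v (θ k + 1)⟫_ℝ)
      + ⟪p - P.dualStep ρ (z (θ k + 1)) (v (θ k)) (q (θ k)),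
        P.residual (z (θ k + 1)) (v (θ k + 1))⟫_ℝ) atTop
      (𝓝 (-(ρ / τ * ⟪u - u, x - u⟫_ℝ) + ⟪p - p, (0 : E)⟫_ℝ)) :=
    (((hv.sub hv').inner (hv'.const_sub x)).const_mul (ρ / τ)).neg.add
      ((hpred.const_sub p).inner hres)
  have hlimit := le_of_tendsto_of_tendsto' hleft hright fun k => h.gap_le hρ hτ (θ k) hw hx p
  simpa only [sub_self, inner_zero_left, inner_zero_right, mul_zero, neg_zero, add_zero,
    sub_nonpos] using hlimit

theorem exists_tendsto [ProperSpace E] [ProperSpace F] (h : IsLinearizedADMM P ρ τ z v q)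
    (hρ : 0 < ρ) (hτ : 0 < τ) (hstep : √τ * ‖P.G‖ < 1) (hK : IsClosed P.K) (hC : IsClosed P.C)
    (hφ : ContinuousOn P.φ P.C) (hs : P.IsSaddle u p) :
    ∃ u' p', P.IsSaddle u' p' ∧ Tendsto v atTop (𝓝 u') ∧
      Tendsto z atTop (𝓝 (P.G u' + P.c)) := by
  obtain ⟨hdv, hdq⟩ := h.tendsto_increments hρ hτ hstep hs
  obtain ⟨⟨u', p'⟩, -, θ, hθ, hlim⟩ := tendsto_subseq_of_bounded
    (h.isBounded_range hρ hτ hstep.le hs) (Set.mem_range_self (f := fun k => (v k, q k)))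
  have hs' : P.IsSaddle u' p' := h.isSaddle_of_tendsto_subseq hρ hτ hK hC hφ hdv hdq
    hθ.tendsto_atTop ((continuous_fst.tendsto _).comp hlim) ((continuous_snd.tendsto _).comp hlim)
  have hpot : Tendsto (fun k => potential ρ τ (u' - v k) (p' - q k)) atTop (𝓝 0) := by
    refine (tendsto_iff_tendsto_subseq_of_antitone
      (h.potential_antitone hρ hτ hstep.le hs') hθ.tendsto_atTop).2 ?_
    simpa [potential, Function.comp_def] using
      ((continuous_potential ρ τ).tendsto _).comp (hlim.const_sub (u', p'))
  have hv : Tendsto v atTop (𝓝 u') := by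
    simpa using (tendsto_zero_of_potential hρ hτ hpot).1.const_sub u'
  exact ⟨u', p', hs', hv, (tendsto_add_atTop_iff_nat 1).1 (P.tendsto_of_tendsto_residual
    (h.tendsto_residual hρ.ne' hdq) ((tendsto_add_atTop_iff_nat 1).2 hv))⟩

end Convergence

theorem ergodic_gap_le (h : IsLinearizedADMM P ρ τ z v q) (hρ : 0 < ρ) (hτ : 0 < τ)
    (hstep : √τ * ‖P.G‖ ≤ 1) (hφ : ConvexOn ℝ P.C P.φ) {k : ℕ} (hk : k ≠ 0)
    {w : E} (hw : w ∈ P.K) {u : F} (hu : u ∈ P.C) (p : E) :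
    P.lagrangian (cesaroMean (fun j => z (j + 1)) k) (cesaroMean (fun j => v (j + 1)) k) p
      - P.lagrangian w u (cesaroMean (fun j => P.dualStep ρ (z (j + 1)) (v j) (q j)) k)
    ≤ (k : ℝ)⁻¹ * potential ρ τ (u - v 0) (p - q 0) := by
  have hdecrease (j : ℕ) : P.lagrangian (z (j + 1)) (v (j + 1)) p
      - P.lagrangian w u (P.dualStep ρ (z (j + 1)) (v j) (q j))
      ≤ -potential ρ τ (u - v (j + 1)) (p - q (j + 1)) - -potential ρ τ (u - v j) (p - q j) := by
    have hgap := h.gap_add_potential_le hρ hτ j hw hu p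
    have hincr := mul_nonneg (sub_nonneg.2 hstep)
      (potential_nonneg hρ hτ (v (j + 1) - v j) (q (j + 1) - q j))
    linarith
  calc _ ≤ cesaroMean (fun j => P.lagrangian (z (j + 1)) (v (j + 1)) p
          - P.lagrangian w u (P.dualStep ρ (z (j + 1)) (v j) (q j))) k := by
        rw [cesaroMean_sub, P.cesaroMean_lagrangian_multiplier w u _ hk]
        gcongr
        exact P.lagrangian_cesaroMean_le hφ _ (fun j => (h.prox j).mem) p hk
    _ ≤ (k : ℝ)⁻¹ * (-potential ρ τ (u - v k) (p - q k)
          - -potential ρ τ (u - v 0) (p - q 0)) :=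
        (cesaroMean_mono hdecrease k).trans_eq
          (cesaroMean_increments (fun j => -potential ρ τ (u - v j) (p - q j)) k)
    _ ≤ (k : ℝ)⁻¹ * potential ρ τ (u - v 0) (p - q 0) := by
        gcongr
        linarith [potential_nonneg hρ hτ (u - v k) (p - q k)]

lemma residual_cesaroMean (h : IsLinearizedADMM P ρ τ z v q) (hρ : ρ ≠ 0) {k : ℕ} (hk : k ≠ 0) :
    P.residual (cesaroMean (fun j => z (j + 1)) k) (cesaroMean (fun j => v (j + 1)) k)
      = ρ⁻¹ • (k : ℝ)⁻¹ • (q k - q 0) := by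
  rw [← P.cesaroMean_residual _ _ hk]
  simp only [h.residual_succ hρ]
  rw [cesaroMean_const_smul, cesaroMean_increments]

lemma exists_norm_residual_cesaroMean_le (h : IsLinearizedADMM P ρ τ z v q) (hρ : 0 < ρ)
    (hτ : 0 < τ) (hstep : √τ * ‖P.G‖ ≤ 1) {u : F} {p : E} (hs : P.IsSaddle u p) :
    ∃ B : ℝ, ∀ k : ℕ, k ≠ 0 → ‖P.residual (cesaroMean (fun j => z (j + 1)) k)
      (cesaroMean (fun j => v (j + 1)) k)‖ ≤ B / k := by
  set B := √(2 * ρ * potential ρ τ (u - v 0) (p - q 0))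
  refine ⟨ρ⁻¹ * (B + B), fun k hk => ?_⟩
  have hdist : ‖q k - q 0‖ ≤ B + B := by
    rw [← sub_sub_sub_cancel_left _ _ p]
    exact (norm_sub_le _ _).trans (add_le_add (h.norm_sub_multiplier_le hρ hτ hstep hs 0)
      (h.norm_sub_multiplier_le hρ hτ hstep hs k))
  rw [h.residual_cesaroMean hρ.ne' hk, norm_smul, norm_smul, Real.norm_of_nonneg (by positivity),
    Real.norm_of_nonneg (by positivity), mul_div_assoc, div_eq_inv_mul]
  gcongr

/-- The gap at the multiplier `0` bounds the objective from above; the saddle inequality and the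
residual bound it from below. -/
theorem exists_ergodic_rate (h : IsLinearizedADMM P ρ τ z v q) (hρ : 0 < ρ) (hτ : 0 < τ)
    (hstep : √τ * ‖P.G‖ ≤ 1) (hφ : ConvexOn ℝ P.C P.φ) (hK : Convex ℝ P.K)
    {u : F} {p : E} (hs : P.IsSaddle u p) :
    ∃ B : ℝ, ∀ k : ℕ, k ≠ 0 →
      |P.φ (cesaroMean (fun j => v (j + 1)) k) - P.φ u| ≤ B / k ∧
      ‖P.residual (cesaroMean (fun j => z (j + 1)) k)
        (cesaroMean (fun j => v (j + 1)) k)‖ ≤ B / k := by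
  obtain ⟨B, hB⟩ := h.exists_norm_residual_cesaroMean_le hρ hτ hstep hs
  set B₀ := potential ρ τ (u - v 0) (0 - q 0)
  refine ⟨max B (max B₀ (‖p‖ * B)), fun k hk => ?_⟩
  set zbar := cesaroMean (fun j => z (j + 1)) k
  set vbar := cesaroMean (fun j => v (j + 1)) k
  have hupper : P.φ vbar - P.φ u ≤ B₀ / k := by
    have hgap := h.ergodic_gap_le hρ hτ hstep hφ hk hs.mem_K hs.mem_C 0
    rwa [P.lagrangian_map_add, SplitProgram.lagrangian, inner_zero_left, add_zero,
      inv_mul_eq_div] at hgap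
  have hlower : P.φ u - P.φ vbar ≤ ‖p‖ * B / k := by
    have hsaddle := hs.le_lagrangian zbar (cesaroMean_mem hK (fun j => (h.proj j).mem) hk)
      vbar (cesaroMean_mem hφ.1 (fun j => (h.prox j).mem) hk)
    calc P.φ u - P.φ vbar ≤ ⟪p, P.residual zbar vbar⟫_ℝ := sub_le_iff_le_add'.2 hsaddle
      _ ≤ ‖p‖ * ‖P.residual zbar vbar‖ := real_inner_le_norm _ _
      _ ≤ ‖p‖ * (B / k) := by gcongr; exact hB k hk
      _ = ‖p‖ * B / k := (mul_div_assoc _ _ _).symm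
  refine ⟨abs_sub_le_iff.2 ⟨hupper.trans ?_, hlower.trans ?_⟩, (hB k hk).trans ?_⟩ <;> gcongr
  · exact (le_max_left _ _).trans (le_max_right _ _)
  · exact (le_max_right _ _).trans (le_max_right _ _)
  · exact le_max_left _ _

end IsLinearizedADMM

end LinearizedADMM

lemma norm_eq_frobNorm {p q : Type*} [Fintype p] [Fintype q] (X : Matrix p q ℝ) :
    ‖X‖ = frobNorm X := by
  simp [Matrix.frobenius_norm_def, frobNorm, Real.sqrt_eq_rpow]

/-- The Frobenius inner product, which induces the Frobenius norm of Mathlib. -/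
@[reducible] def frobeniusInnerProductSpace {p q : Type*} [Fintype p] [Fintype q] :
    InnerProductSpace ℝ (Matrix p q ℝ) where
  inner := frobInner
  norm_sq_eq_re_inner X := by
    rw [norm_eq_frobNorm, frobNorm, Real.sq_sqrt (by positivity)]
    simp [frobInner, sq]
  conj_inner_symm X Y := by simp [frobInner, mul_comm]
  add_left X Y Z := by simp [frobInner, add_mul, Finset.sum_add_distrib]
  smul_left X Y r := by simp [frobInner, Finset.mul_sum, mul_assoc]

attribute [local instance] frobeniusInnerProductSpace

section FrobeniusInner

variable {p q r : Type*} [Fintype p] [Fintype q]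

lemma inner_eq_sum (X Y : Matrix p q ℝ) : ⟪X, Y⟫_ℝ = ∑ i, ∑ j, X i j * Y i j := rfl

lemma norm_sq_eq_sum (X : Matrix p q ℝ) : ‖X‖ ^ 2 = ∑ i, ∑ j, X i j ^ 2 := by
  rw [← real_inner_self_eq_norm_sq, inner_eq_sum]
  simp only [sq]

lemma inner_eq_trace (X Y : Matrix p q ℝ) : ⟪X, Y⟫_ℝ = (Yᵀ * X).trace := by
  simp only [inner_eq_sum, Matrix.trace, Matrix.diag, Matrix.mul_apply, Matrix.transpose_apply]
  rw [Finset.sum_comm]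
  simp only [mul_comm]

lemma inner_transpose (X Y : Matrix p q ℝ) : ⟪Xᵀ, Yᵀ⟫_ℝ = ⟪X, Y⟫_ℝ :=
  Finset.sum_comm

variable [Fintype r] [DecidableEq r]

lemma inner_mul_diagonal_mul (K : Matrix p q ℝ) (U : Matrix p r ℝ) (s : r → ℝ)
    (V : Matrix q r ℝ) :
    ⟪K, U * Matrix.diagonal s * Vᵀ⟫_ℝ = ∑ i, s i * (Uᵀ * K * V) i i := by
  rw [inner_eq_trace, Matrix.transpose_mul, Matrix.transpose_mul, Matrix.transpose_transpose,
    Matrix.diagonal_transpose, Matrix.mul_assoc, Matrix.trace_mul_comm]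
  simp only [Matrix.trace, Matrix.diag, Matrix.mul_assoc, Matrix.diagonal_mul]

lemma inner_mul_diagonal_mul_self {U : Matrix p r ℝ} {V : Matrix q r ℝ}
    (hU : Uᵀ * U = 1) (hV : Vᵀ * V = 1) (s t : r → ℝ) :
    ⟪U * Matrix.diagonal s * Vᵀ, U * Matrix.diagonal t * Vᵀ⟫_ℝ = ∑ i, t i * s i := by
  have h : Uᵀ * (U * Matrix.diagonal s * Vᵀ) * V = Matrix.diagonal s := by
    rw [← Matrix.mul_assoc, ← Matrix.mul_assoc, hU, Matrix.one_mul, Matrix.mul_assoc, hV,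
      Matrix.mul_one]
  simp only [inner_mul_diagonal_mul, h, Matrix.diagonal_apply_eq]

end FrobeniusInner

section Contraction

variable {p q r : Type*} [Fintype p] [Fintype q] [DecidableEq r]

/-- `K` has spectral norm at most one. The bilinear inequality used as the definition is the form
in which both the singular vectors and the duality with the nuclear norm enter. -/
def IsContraction (K : Matrix p q ℝ) : Prop :=
  ∀ (u : p → ℝ) (v : q → ℝ), 2 * (u ⬝ᵥ K *ᵥ v) ≤ u ⬝ᵥ u + v ⬝ᵥ v

lemma dotProduct_col_self {U : Matrix p r ℝ} (hU : Uᵀ * U = 1) (i : r) :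
    U.col i ⬝ᵥ U.col i = 1 := by
  simpa [Matrix.mul_apply, dotProduct] using congrFun (congrFun hU i) i

lemma IsContraction.transpose_mul_mul_apply_self_le_one {K : Matrix p q ℝ} (hK : IsContraction K)
    {U : Matrix p r ℝ} {V : Matrix q r ℝ} (hU : Uᵀ * U = 1) (hV : Vᵀ * V = 1) (i : r) :
    (Uᵀ * K * V) i i ≤ 1 := by
  have h := hK (U.col i) (V.col i)
  have hentry : (Uᵀ * K * V) i i = U.col i ⬝ᵥ K *ᵥ V.col i := by
    rw [Matrix.mul_assoc]
    rfl
  rw [dotProduct_col_self hU, dotProduct_col_self hV, ← hentry] at h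
  linarith

variable [Fintype r]

lemma transpose_mulVec_dotProduct_self_le {U : Matrix p r ℝ} (hU : Uᵀ * U = 1) (u : p → ℝ) :
    Uᵀ *ᵥ u ⬝ᵥ Uᵀ *ᵥ u ≤ u ⬝ᵥ u := by
  set w := Uᵀ *ᵥ u with hw
  have hnonneg : 0 ≤ (u - U *ᵥ w) ⬝ᵥ (u - U *ᵥ w) :=
    Finset.sum_nonneg fun i _ => mul_self_nonneg _
  have hcross : U *ᵥ w ⬝ᵥ u = w ⬝ᵥ w := by
    rw [dotProduct_comm, Matrix.dotProduct_mulVec, ← Matrix.mulVec_transpose, ← hw]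
  have hproj : U *ᵥ w ⬝ᵥ U *ᵥ w = w ⬝ᵥ w := by
    rw [Matrix.dotProduct_mulVec, ← Matrix.mulVec_transpose, Matrix.mulVec_mulVec, hU,
      Matrix.one_mulVec]
  rw [sub_dotProduct, dotProduct_sub, dotProduct_sub, hproj,
    dotProduct_comm u (U *ᵥ w), hcross] at hnonneg
  linarith

lemma isContraction_mul_diagonal_mul {U : Matrix p r ℝ} {V : Matrix q r ℝ}
    (hU : Uᵀ * U = 1) (hV : Vᵀ * V = 1) {w : r → ℝ} (hw₀ : ∀ i, 0 ≤ w i) (hw₁ : ∀ i, w i ≤ 1) :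
    IsContraction (U * Matrix.diagonal w * Vᵀ) := by
  intro u v
  have hscalar (a b c : ℝ) (hc₀ : 0 ≤ c) (hc₁ : c ≤ 1) : 2 * (a * (c * b)) ≤ a * a + b * b := by
    nlinarith [mul_nonneg hc₀ (sq_nonneg (a - b)), mul_nonneg (sub_nonneg.2 hc₁) (sq_nonneg a),
      mul_nonneg (sub_nonneg.2 hc₁) (sq_nonneg b)]
  calc 2 * (u ⬝ᵥ (U * Matrix.diagonal w * Vᵀ) *ᵥ v)
      = ∑ i, 2 * ((Uᵀ *ᵥ u) i * (w i * (Vᵀ *ᵥ v) i)) := by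
        rw [← Matrix.mulVec_mulVec, ← Matrix.mulVec_mulVec, Matrix.dotProduct_mulVec,
          ← Matrix.mulVec_transpose, ← Finset.mul_sum]
        simp only [dotProduct, Matrix.mulVec_diagonal]
    _ ≤ ∑ i, ((Uᵀ *ᵥ u) i * (Uᵀ *ᵥ u) i + (Vᵀ *ᵥ v) i * (Vᵀ *ᵥ v) i) :=
        Finset.sum_le_sum fun i _ => hscalar _ _ _ (hw₀ i) (hw₁ i)
    _ ≤ u ⬝ᵥ u + v ⬝ᵥ v := by
        rw [Finset.sum_add_distrib]
        exact add_le_add (transpose_mulVec_dotProduct_self_le hU u)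
          (transpose_mulVec_dotProduct_self_le hV v)

lemma IsContraction.inner_mul_diagonal_mul_le {K : Matrix p q ℝ} (hK : IsContraction K)
    {U : Matrix p r ℝ} {V : Matrix q r ℝ} (hU : Uᵀ * U = 1) (hV : Vᵀ * V = 1) {s : r → ℝ}
    (hs : ∀ i, 0 ≤ s i) : ⟪K, U * Matrix.diagonal s * Vᵀ⟫_ℝ ≤ ∑ i, s i := by
  rw [inner_mul_diagonal_mul]
  exact Finset.sum_le_sum fun i _ =>
    mul_le_of_le_one_right (hs i) (hK.transpose_mul_mul_apply_self_le_one hU hV i)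

end Contraction

section ThinSVD

variable {p q r : Type*} [Fintype p] [Fintype q] [Fintype r] [DecidableEq r]

/-- `X = U * diagonal s * Vᵀ` is a thin singular value decomposition: `U` and `V` have orthonormal
columns and `s` is nonnegative, but neither the order of the `s i` nor their positivity is
prescribed. -/
structure IsThinSVD (X : Matrix p q ℝ) (U : Matrix p r ℝ) (s : r → ℝ) (V : Matrix q r ℝ) :
    Prop where
  left : Uᵀ * U = 1
  right : Vᵀ * V = 1
  nonneg : ∀ i, 0 ≤ s i
  eq : X = U * Matrix.diagonal s * Vᵀ

lemma isThinSVD_of_gram_diagonal [DecidableEq q] {X : Matrix p q ℝ} {E : Matrix q q ℝ}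
    (hE : Eᵀ * E = 1) {σ : q → ℝ} (hσ : ∀ i, 0 ≤ σ i)
    (hgram : (X * E)ᵀ * (X * E) = Matrix.diagonal fun i => σ i ^ 2) {ι : r → q}
    (hι : ι.Injective) (hne : ∀ i, σ (ι i) ≠ 0) (hzero : ∀ j ∉ Set.range ι, σ j = 0) :
    IsThinSVD X ((X * E).submatrix id ι * Matrix.diagonal fun i => (σ (ι i))⁻¹) (σ ∘ ι)
      (E.submatrix id ι) where
  left := by
    have hsub : ((X * E).submatrix id ι)ᵀ * (X * E).submatrix id ι
        = Matrix.diagonal fun i => σ (ι i) ^ 2 := by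
      rw [Matrix.transpose_submatrix, ← Matrix.submatrix_mul _ _ ι id ι Function.bijective_id,
        hgram, Matrix.submatrix_diagonal _ _ hι]
      rfl
    rw [Matrix.transpose_mul, Matrix.diagonal_transpose, Matrix.mul_assoc,
      ← Matrix.mul_assoc _ᵀ, hsub, Matrix.diagonal_mul_diagonal, Matrix.diagonal_mul_diagonal,
      ← Matrix.diagonal_one]
    congr 1
    funext i
    field_simp [hne i]
  right := by
    rw [Matrix.transpose_submatrix, ← Matrix.submatrix_mul _ _ ι id ι Function.bijective_id, hE,
      Matrix.submatrix_one _ hι]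
  nonneg i := hσ (ι i)
  eq := by
    have hcol (j : q) (hj : j ∉ Set.range ι) (a : p) : (X * E) a j = 0 := by
      have h : ∑ b, (X * E) b j * (X * E) b j = 0 := by
        have h := congrFun (congrFun hgram j) j
        rwa [Matrix.diagonal_apply_eq, hzero j hj, zero_pow two_ne_zero] at h
      rw [Finset.sum_eq_zero_iff_of_nonneg fun _ _ => mul_self_nonneg _] at h
      exact mul_self_eq_zero.1 (h a (Finset.mem_univ a))
    have hcancel : (Matrix.diagonal fun i => (σ (ι i))⁻¹) * Matrix.diagonal (σ ∘ ι) = 1 := by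
      simp [Matrix.diagonal_mul_diagonal, hne]
    rw [Matrix.mul_assoc _ _ (Matrix.diagonal _), hcancel, Matrix.mul_one]
    calc X = X * E * Eᵀ := by rw [Matrix.mul_assoc, mul_eq_one_comm.1 hE, Matrix.mul_one]
      _ = (X * E).submatrix id ι * (E.submatrix id ι)ᵀ := by
        ext a b
        exact (Fintype.sum_of_injective ι hι _ _
          (fun j hj => mul_eq_zero_of_left (hcol j hj a) _) fun _ => rfl).symm

variable {X : Matrix p q ℝ} {U : Matrix p r ℝ} {s : r → ℝ} {V : Matrix q r ℝ}

lemma IsThinSVD.inner_le_sum (h : IsThinSVD X U s V) {K : Matrix p q ℝ} (hK : IsContraction K) :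
    ⟪K, X⟫_ℝ ≤ ∑ i, s i := by
  rw [h.eq]
  exact hK.inner_mul_diagonal_mul_le h.left h.right h.nonneg

lemma IsThinSVD.exists_isContraction_inner_eq_sum (h : IsThinSVD X U s V) :
    ∃ K : Matrix p q ℝ, IsContraction K ∧ ⟪K, X⟫_ℝ = ∑ i, s i := by
  refine ⟨U * Matrix.diagonal 1 * Vᵀ,
    isContraction_mul_diagonal_mul h.left h.right (fun _ => zero_le_one) fun _ => le_rfl, ?_⟩
  rw [h.eq, inner_mul_diagonal_mul_self h.left h.right]
  simp

lemma IsThinSVD.norm_sq_eq (h : IsThinSVD X U s V) : ‖X‖ ^ 2 = ∑ i, s i ^ 2 := by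
  rw [← real_inner_self_eq_norm_sq, h.eq, inner_mul_diagonal_mul_self h.left h.right]
  simp only [sq]

end ThinSVD

section NuclearNorm

variable {m n : ℕ}

lemma exists_orthogonal_gram_diagonal (X : Matrix (Fin m) (Fin n) ℝ) :
    ∃ E : Matrix (Fin n) (Fin n) ℝ, Eᵀ * E = 1 ∧ (X * E)ᵀ * (X * E)
      = Matrix.diagonal fun i : Fin n => (Matrix.toEuclideanLin X).singularValues i ^ 2 := by
  set T := Matrix.toEuclideanLin X
  have hn : Module.finrank ℝ (EuclideanSpace ℝ (Fin n)) = n := by simp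
  set e := T.isSymmetric_adjoint_comp_self.eigenvectorBasis hn
  refine ⟨Matrix.of fun b j => e j b, ?_, ?_⟩
  · ext i j
    rw [Matrix.one_apply, ← orthonormal_iff_ite.1 e.orthonormal i j, PiLp.inner_apply,
      Matrix.mul_apply]
    exact Finset.sum_congr rfl fun a _ => mul_comm (e i a) (e j a)
  · have h (i j : Fin n) : ⟪T (e i), T (e j)⟫_ℝ = if i = j then T.singularValues i ^ 2 else 0 := by
      rw [← LinearMap.adjoint_inner_right, ← LinearMap.comp_apply,
        T.isSymmetric_adjoint_comp_self.apply_eigenvectorBasis hn j, inner_smul_right,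
        orthonormal_iff_ite.1 e.orthonormal i j, T.sq_singularValues_fin hn i]
      split_ifs with hij <;> simp [hij]
    ext i j
    rw [Matrix.diagonal_apply, ← h, PiLp.inner_apply, Matrix.mul_apply]
    exact Finset.sum_congr rfl fun a _ => mul_comm (T (e i) a) (T (e j) a)

lemma exists_isThinSVD_sum_eq_nuclearNorm (X : Matrix (Fin m) (Fin n) ℝ) :
    ∃ (r : ℕ) (U : Matrix (Fin m) (Fin r) ℝ) (s : Fin r → ℝ) (V : Matrix (Fin n) (Fin r) ℝ),
      IsThinSVD X U s V ∧ ∑ i, s i = nuclearNorm X := by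
  obtain ⟨E, hE, hgram⟩ := exists_orthogonal_gram_diagonal X
  set σ : Fin n → ℝ := fun i => (Matrix.toEuclideanLin X).singularValues i
  let e := Fintype.equivFin {i // σ i ≠ 0}
  let ι : Fin (Fintype.card {i // σ i ≠ 0}) → Fin n := fun a => (e.symm a).1
  have hι : ι.Injective := Subtype.val_injective.comp e.symm.injective
  have hzero : ∀ j ∉ Set.range ι, σ j = 0 := fun j hj =>
    by_contra fun hne => hj ⟨e ⟨j, hne⟩, by simp [ι]⟩
  exact ⟨_, _, _, _, isThinSVD_of_gram_diagonal hE (fun i => LinearMap.singularValues_nonneg _ _)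
    hgram hι (fun a => (e.symm a).2) hzero,
    Fintype.sum_of_injective ι hι _ _ hzero fun _ => rfl⟩

lemma IsContraction.inner_le_nuclearNorm {K : Matrix (Fin m) (Fin n) ℝ} (hK : IsContraction K)
    (X : Matrix (Fin m) (Fin n) ℝ) : ⟪K, X⟫_ℝ ≤ nuclearNorm X := by
  obtain ⟨r, U, s, V, hX, hsum⟩ := exists_isThinSVD_sum_eq_nuclearNorm X
  exact hsum ▸ hX.inner_le_sum hK

lemma exists_isContraction_inner_eq_nuclearNorm (X : Matrix (Fin m) (Fin n) ℝ) :
    ∃ K : Matrix (Fin m) (Fin n) ℝ, IsContraction K ∧ ⟪K, X⟫_ℝ = nuclearNorm X := by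
  obtain ⟨r, U, s, V, hX, hsum⟩ := exists_isThinSVD_sum_eq_nuclearNorm X
  exact hsum ▸ hX.exists_isContraction_inner_eq_sum

lemma IsThinSVD.nuclearNorm_eq {r : Type*} [Fintype r] [DecidableEq r]
    {X : Matrix (Fin m) (Fin n) ℝ} {U : Matrix (Fin m) r ℝ} {s : r → ℝ}
    {V : Matrix (Fin n) r ℝ} (h : IsThinSVD X U s V) : nuclearNorm X = ∑ i, s i := by
  obtain ⟨K, hK, hKX⟩ := exists_isContraction_inner_eq_nuclearNorm X
  obtain ⟨K', hK', hKX'⟩ := h.exists_isContraction_inner_eq_sum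
  exact le_antisymm (hKX ▸ h.inner_le_sum hK) (hKX' ▸ hK'.inner_le_nuclearNorm X)

lemma convexOn_nuclearNorm :
    ConvexOn ℝ Set.univ (nuclearNorm : Matrix (Fin m) (Fin n) ℝ → ℝ) := by
  refine ⟨convex_univ, fun X _ Y _ a b ha hb _ => ?_⟩
  obtain ⟨K, hK, h⟩ := exists_isContraction_inner_eq_nuclearNorm (a • X + b • Y)
  rw [← h, inner_add_right, inner_smul_right, inner_smul_right, smul_eq_mul, smul_eq_mul]
  gcongr <;> exact hK.inner_le_nuclearNorm _

lemma continuous_nuclearNorm : Continuous (nuclearNorm : Matrix (Fin m) (Fin n) ℝ → ℝ) :=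
  continuousOn_univ.1 (convexOn_nuclearNorm.continuousOn isOpen_univ)

lemma norm_le_nuclearNorm (X : Matrix (Fin m) (Fin n) ℝ) : ‖X‖ ≤ nuclearNorm X := by
  obtain ⟨r, U, s, V, hX, hsum⟩ := exists_isThinSVD_sum_eq_nuclearNorm X
  rw [← hsum]
  refine abs_le_of_sq_le_sq' ?_ (Finset.sum_nonneg fun i _ => hX.nonneg i) |>.2
  rw [hX.norm_sq_eq]
  exact Finset.sum_sq_le_sq_sum_of_nonneg fun i _ => hX.nonneg i

end NuclearNorm

section L1Norm

variable {m n : ℕ}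

lemma convexOn_l1Norm : ConvexOn ℝ Set.univ (l1Norm : Matrix (Fin m) (Fin n) ℝ → ℝ) := by
  refine ⟨convex_univ, fun X _ Y _ a b ha hb _ => ?_⟩
  simp only [l1Norm, smul_eq_mul, Finset.mul_sum, ← Finset.sum_add_distrib]
  gcongr with i _ j _
  rw [Matrix.add_apply, Matrix.smul_apply, Matrix.smul_apply, smul_eq_mul, smul_eq_mul]
  refine (abs_add_le _ _).trans_eq ?_
  rw [abs_mul, abs_mul, abs_of_nonneg ha, abs_of_nonneg hb]

lemma continuous_l1Norm : Continuous (l1Norm : Matrix (Fin m) (Fin n) ℝ → ℝ) := by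
  unfold l1Norm
  fun_prop

lemma norm_le_l1Norm (X : Matrix (Fin m) (Fin n) ℝ) : ‖X‖ ≤ l1Norm X := by
  have hrow (i : Fin m) : 0 ≤ ∑ j, |X i j| := Finset.sum_nonneg fun _ _ => abs_nonneg _
  refine abs_le_of_sq_le_sq' ?_ (Finset.sum_nonneg fun i _ => hrow i) |>.2
  calc ‖X‖ ^ 2 = ∑ i, ∑ j, |X i j| ^ 2 := by simp only [norm_sq_eq_sum, sq_abs]
    _ ≤ ∑ i, (∑ j, |X i j|) ^ 2 := by
      gcongr with i
      exact Finset.sum_sq_le_sq_sum_of_nonneg fun _ _ => abs_nonneg _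
    _ ≤ l1Norm X ^ 2 := Finset.sum_sq_le_sq_sum_of_nonneg fun i _ => hrow i

end L1Norm

section Shrinkage

lemma shrink_of_nonneg {θ x : ℝ} (hθ : 0 ≤ θ) (hx : 0 ≤ x) : shrink θ x = max (x - θ) 0 := by
  rcases hx.eq_or_lt with rfl | hx
  · simp [shrink, hθ]
  · rw [shrink, Real.sign_of_pos hx, abs_of_pos hx, one_mul]

lemma shrink_neg (θ x : ℝ) : shrink θ (-x) = -shrink θ x := by
  simp [shrink, Real.sign_neg]

lemma mul_abs_shrink_add_le {θ : ℝ} (hθ : 0 ≤ θ) (x z : ℝ) :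
    θ * |shrink θ x| + (x - shrink θ x) * (z - shrink θ x) ≤ θ * |z| := by
  wlog hx : 0 ≤ x generalizing x z
  · have h := this (-x) (-z) (by linarith)
    rw [shrink_neg, abs_neg, abs_neg] at h
    linarith
  rw [shrink_of_nonneg hθ hx]
  rcases le_total (x - θ) 0 with hxθ | hxθ
  · rw [max_eq_right hxθ, abs_zero, mul_zero, sub_zero, sub_zero, zero_add]
    calc x * z ≤ x * |z| := by gcongr; exact le_abs_self z
      _ ≤ θ * |z| := by gcongr; linarith
  · rw [max_eq_left hxθ, abs_of_nonneg hxθ]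
    nlinarith [mul_le_mul_of_nonneg_left (le_abs_self z) hθ]

variable {m n : ℕ}

lemma isProxPoint_map_shrink {θ : ℝ} (hθ : 0 ≤ θ) (X : Matrix (Fin m) (Fin n) ℝ) :
    IsProxPoint Set.univ (θ • l1Norm) X (X.map (shrink θ)) where
  mem := Set.mem_univ _
  le W _ := by
    simp only [Pi.smul_apply, smul_eq_mul, l1Norm, inner_eq_sum, Finset.mul_sum,
      ← Finset.sum_add_distrib]
    exact Finset.sum_le_sum fun i _ => Finset.sum_le_sum fun j _ => mul_abs_shrink_add_le hθ _ _

/-- The matrices with nonnegative entries. -/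
def nonnegCone (p q : Type*) : Set (Matrix p q ℝ) := {μ | ∀ i j, 0 ≤ μ i j}

lemma convex_nonnegCone (p q : Type*) : Convex ℝ (nonnegCone p q) :=
  fun _ hμ _ hν _ _ ha hb _ i j => add_nonneg (mul_nonneg ha (hμ i j)) (mul_nonneg hb (hν i j))

lemma isClosed_nonnegCone (p q : Type*) : IsClosed (nonnegCone p q) := by
  simp only [nonnegCone, Set.ofPred_forall]
  exact isClosed_iInter fun i => isClosed_iInter fun j =>
    isClosed_le continuous_const (by fun_prop)

lemma isProxPoint_map_max_zero {p q : Type*} [Fintype p] [Fintype q] (X : Matrix p q ℝ) :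
    IsProxPoint (nonnegCone p q) 0 X (X.map fun x => max x 0) where
  mem i j := le_max_right _ _
  le W hW := by
    rw [Pi.zero_apply, Pi.zero_apply, zero_add]
    refine Finset.sum_nonpos fun i _ => Finset.sum_nonpos fun j _ => ?_
    simp only [Matrix.sub_apply, Matrix.map_apply]
    rcases le_total (X i j) 0 with hX | hX
    · rw [max_eq_right hX, sub_zero, sub_zero]
      exact mul_nonpos_of_nonpos_of_nonneg hX (hW i j)
    · rw [max_eq_left hX, sub_self, zero_mul]

-- For every `s ≥ 0`, `s - max (s - θ) 0 = θ * min (s / θ) 1`, so the residual `X - D` is `θ` times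
-- a contraction which attains the nuclear norm of `D`, i.e. `θ` times a subgradient.
lemma IsSingularThreshold.exists_isContraction {θ : ℝ} (hθ : 0 < θ)
    {X D : Matrix (Fin m) (Fin n) ℝ} (h : IsSingularThreshold θ X D) :
    ∃ K, IsContraction K ∧ X - D = θ • K ∧ ⟪K, D⟫_ℝ = nuclearNorm D := by
  obtain ⟨r, U, V, s, hU, hV, hs, hX, hD⟩ := h
  simp only [shrink_of_nonneg hθ.le (hs _)] at hD
  have hDsvd : IsThinSVD D U (fun i => max (s i - θ) 0) V :=
    ⟨hU, hV, fun i => le_max_right _ _, hD⟩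
  refine ⟨U * Matrix.diagonal (fun i => min (s i / θ) 1) * Vᵀ,
    isContraction_mul_diagonal_mul hU hV
      (fun i => le_min (div_nonneg (hs i) hθ.le) zero_le_one) fun i => min_le_right _ _, ?_, ?_⟩
  · rw [hX, hD, ← Matrix.sub_mul, ← Matrix.mul_sub, Matrix.diagonal_sub, ← Matrix.smul_mul,
      ← Matrix.mul_smul, ← Matrix.diagonal_smul]
    congr 3
    funext i
    simp only [Pi.smul_apply, smul_eq_mul]
    rcases le_total (s i) θ with hsθ | hsθ
    · rw [max_eq_right (by linarith), min_eq_left ((div_le_one hθ).2 hsθ)]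
      field_simp
      ring
    · rw [max_eq_left (by linarith), min_eq_right ((one_le_div hθ).2 hsθ)]
      ring
  · rw [hDsvd.nuclearNorm_eq, hD, inner_mul_diagonal_mul_self hU hV]
    refine Finset.sum_congr rfl fun i _ => ?_
    rcases le_total (s i) θ with hsθ | hsθ
    · rw [max_eq_right (by linarith), zero_mul]
    · rw [min_eq_right ((one_le_div hθ).2 hsθ), mul_one]

lemma IsSingularThreshold.isProxPoint {θ : ℝ} (hθ : 0 < θ) {X D : Matrix (Fin m) (Fin n) ℝ}
    (h : IsSingularThreshold θ X D) : IsProxPoint Set.univ (θ • nuclearNorm) X D where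
  mem := Set.mem_univ _
  le W _ := by
    obtain ⟨K, hK, hXD, hKD⟩ := h.exists_isContraction hθ
    rw [hXD, inner_smul_left, inner_sub_right, hKD]
    calc (θ • nuclearNorm) D + θ * (⟪K, W⟫_ℝ - nuclearNorm D) = θ * ⟪K, W⟫_ℝ := by
          rw [Pi.smul_apply, smul_eq_mul]
          ring
      _ ≤ θ * nuclearNorm W := by
        gcongr
        exact hK.inner_le_nuclearNorm W

lemma exists_isSingularThreshold (θ : ℝ) (X : Matrix (Fin m) (Fin n) ℝ) :
    ∃ D, IsSingularThreshold θ X D := by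
  obtain ⟨r, U, s, V, h, -⟩ := exists_isThinSVD_sum_eq_nuclearNorm X
  exact ⟨_, r, U, V, s, h.left, h.right, h.nonneg, h.eq, rfl⟩

end Shrinkage

section PosPart

variable {p : Type*} [Fintype p] [DecidableEq p]

lemma posSemidef_mul_diagonal_mul (Q : Matrix p p ℝ) {d : p → ℝ} (hd : ∀ i, 0 ≤ d i) :
    (Q * Matrix.diagonal d * Qᵀ).PosSemidef := by
  simpa using (Matrix.PosSemidef.diagonal (n := p) (d := d) hd).mul_mul_conjTranspose_same Q

lemma inner_mul_diagonal_mul_nonneg (Q : Matrix p p ℝ) {d : p → ℝ} (hd : ∀ i, 0 ≤ d i)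
    {P : Matrix p p ℝ} (hP : P.PosSemidef) : 0 ≤ ⟪Q * Matrix.diagonal d * Qᵀ, P⟫_ℝ := by
  rw [real_inner_comm, inner_mul_diagonal_mul]
  have hconj := hP.conjTranspose_mul_mul_same Q
  exact Finset.sum_nonneg fun i _ => mul_nonneg (hd i) hconj.diag_nonneg

variable {W Z : Matrix p p ℝ}

lemma IsPosPart.posSemidef (h : IsPosPart W Z) : Z.PosSemidef := by
  obtain ⟨Q, d, -, -, rfl⟩ := h
  exact posSemidef_mul_diagonal_mul Q fun i => le_max_right _ _

lemma IsPosPart.isSymm (h : IsPosPart W Z) : W.IsSymm := by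
  obtain ⟨Q, d, -, rfl, -⟩ := h
  simp [Matrix.IsSymm, Matrix.mul_assoc]

lemma IsPosPart.isProxPoint (h : IsPosPart W Z) :
    IsProxPoint {Z : Matrix p p ℝ | Z.PosSemidef} 0 W Z where
  mem := h.posSemidef
  le P hP := by
    obtain ⟨Q, d, hQ, hW, hZ⟩ := h
    have hWZ : W - Z = -(Q * Matrix.diagonal (fun i => max (d i) 0 - d i) * Qᵀ) := by
      rw [← neg_sub, hZ, hW, ← Matrix.sub_mul, ← Matrix.mul_sub, Matrix.diagonal_sub]
    have horth : ⟪W - Z, Z⟫_ℝ = 0 := by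
      rw [hWZ, hZ, inner_neg_left, inner_mul_diagonal_mul_self hQ hQ, neg_eq_zero]
      refine Finset.sum_eq_zero fun i _ => ?_
      rcases le_total (d i) 0 with hd | hd
      · rw [max_eq_right hd, zero_mul]
      · rw [max_eq_left hd, sub_self, mul_zero]
    rw [inner_sub_right, horth, sub_zero, hWZ, inner_neg_left, Pi.zero_apply, Pi.zero_apply,
      zero_add, neg_nonpos]
    exact inner_mul_diagonal_mul_nonneg Q (fun i => sub_nonneg.2 (le_max_left _ _)) hP

lemma exists_isPosPart (hW : W.IsSymm) : ∃ Z, IsPosPart W Z := by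
  have hH : W.IsHermitian := by
    rwa [Matrix.IsHermitian, Matrix.conjTranspose_eq_transpose_of_trivial]
  refine ⟨_, (hH.eigenvectorUnitary : Matrix p p ℝ), hH.eigenvalues, ?_, ?_, rfl⟩
  · simpa only [Matrix.star_eq_conjTranspose, Matrix.conjTranspose_eq_transpose_of_trivial] using
      Unitary.coe_star_mul_self hH.eigenvectorUnitary
  · rw [← Matrix.conjTranspose_eq_transpose_of_trivial, ← Matrix.star_eq_conjTranspose]
    exact hH.spectral_theorem

end PosPart

section QuadraticForm

variable {p : Type*} [Fintype p]

/-- The matrices with positive definite quadratic form. Symmetry is not required, so that the set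
is open in the space of all matrices. -/
def posQuad (p : Type*) [Fintype p] : Set (Matrix p p ℝ) :=
  {W | ∀ x : p → ℝ, x ≠ 0 → 0 < x ⬝ᵥ W *ᵥ x}

lemma smul_dotProduct_mulVec_smul (c : ℝ) (W : Matrix p p ℝ) (x : p → ℝ) :
    c • x ⬝ᵥ W *ᵥ (c • x) = c ^ 2 * (x ⬝ᵥ W *ᵥ x) := by
  rw [Matrix.mulVec_smul, smul_dotProduct, dotProduct_smul, smul_eq_mul, smul_eq_mul]
  ring

lemma isOpen_posQuad : IsOpen (posQuad p) := by
  rw [isOpen_iff_mem_nhds]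
  intro W hW
  have hcont : Continuous fun z : Matrix p p ℝ × (p → ℝ) => z.2 ⬝ᵥ z.1 *ᵥ z.2 := by fun_prop
  -- By homogeneity, positivity on the unit sphere suffices.
  have hsphere : ∀ᶠ V in 𝓝 W, ∀ x ∈ Metric.sphere (0 : p → ℝ) 1, 0 < x ⬝ᵥ V *ᵥ x :=
    (isCompact_sphere 0 1).eventually_forall_of_forall_eventually fun x hx =>
      (isOpen_lt continuous_const hcont).mem_nhds
        (hW x (ne_zero_of_mem_unit_sphere ⟨x, hx⟩))
  filter_upwards [hsphere] with V hV x hx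
  have : 0 < ‖x‖⁻¹ := inv_pos.2 (norm_pos_iff.2 hx)
  have h := hV (‖x‖⁻¹ • x) (by simp [norm_smul, hx])
  rw [smul_dotProduct_mulVec_smul] at h
  exact pos_of_mul_pos_right h (by positivity)

lemma dotProduct_mulVec_nonneg_of_mem_posQuad {W : Matrix p p ℝ} (hW : W ∈ posQuad p)
    (x : p → ℝ) : 0 ≤ x ⬝ᵥ W *ᵥ x := by
  rcases eq_or_ne x 0 with rfl | hx
  · simp
  · exact (hW x hx).le

lemma smul_mem_posQuad {W : Matrix p p ℝ} (hW : W ∈ posQuad p) {c : ℝ} (hc : 0 < c) :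
    c • W ∈ posQuad p := fun x hx => by
  rw [Matrix.smul_mulVec, dotProduct_smul]
  exact mul_pos hc (hW x hx)

lemma add_mem_posQuad {V W : Matrix p p ℝ} (hV : ∀ x : p → ℝ, 0 ≤ x ⬝ᵥ V *ᵥ x)
    (hW : W ∈ posQuad p) : V + W ∈ posQuad p := fun x hx => by
  rw [Matrix.add_mulVec, dotProduct_add]
  exact add_pos_of_nonneg_of_pos (hV x) (hW x hx)

lemma convex_posQuad : Convex ℝ (posQuad p) :=
  convex_iff_forall_pos.2 fun _ hV _ hW _ _ ha hb _ =>
    add_mem_posQuad (dotProduct_mulVec_nonneg_of_mem_posQuad (smul_mem_posQuad hV ha))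
      (smul_mem_posQuad hW hb)

lemma one_mem_posQuad [DecidableEq p] : (1 : Matrix p p ℝ) ∈ posQuad p := fun x hx => by
  rw [Matrix.one_mulVec]
  exact (Finset.sum_nonneg fun i _ => mul_self_nonneg (x i)).lt_of_ne'
    (dotProduct_self_eq_zero.not.2 hx)

lemma mem_closure_posQuad {W : Matrix p p ℝ}
    (hW : ∀ x : p → ℝ, 0 ≤ x ⬝ᵥ W *ᵥ x) : W ∈ closure (posQuad p) := by
  classical
  have hlim : Tendsto (fun ε : ℝ => W + ε • (1 : Matrix p p ℝ)) (𝓝[>] 0) (𝓝 W) := by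
    have hcont : Continuous fun ε : ℝ => W + ε • (1 : Matrix p p ℝ) := by fun_prop
    simpa using (hcont.tendsto 0).mono_left nhdsWithin_le_nhds
  exact mem_closure_of_tendsto hlim <| eventually_mem_nhdsWithin.mono fun ε hε =>
    add_mem_posQuad hW (smul_mem_posQuad one_mem_posQuad hε)

lemma posSemidef_iff_isSymm_and_dotProduct_mulVec_nonneg {W : Matrix p p ℝ} :
    W.PosSemidef ↔ W.IsSymm ∧ ∀ x : p → ℝ, 0 ≤ x ⬝ᵥ W *ᵥ x := by
  rw [Matrix.posSemidef_iff_dotProduct_mulVec, Matrix.IsHermitian,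
    Matrix.conjTranspose_eq_transpose_of_trivial]
  rfl

end QuadraticForm

section DoublyNonnegative

variable {p q : Type*} [Fintype p] [Fintype q]

lemma inner_single [DecidableEq p] [DecidableEq q] (X : Matrix p q ℝ) (i : p) (j : q) (c : ℝ) :
    ⟪X, Matrix.single i j c⟫_ℝ = X i j * c := by
  simp [inner_eq_sum, Matrix.single_apply, ite_and]

lemma inner_vecMulVec (X : Matrix p q ℝ) (u : p → ℝ) (v : q → ℝ) :
    ⟪X, Matrix.vecMulVec u v⟫_ℝ = u ⬝ᵥ X *ᵥ v := by
  simp only [inner_eq_sum, dotProduct, Matrix.mulVec, Matrix.vecMulVec_apply, Finset.mul_sum]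
  exact Finset.sum_congr rfl fun i _ => Finset.sum_congr rfl fun j _ => by ring

lemma inner_transpose_mul_self (X : Matrix q q ℝ) (A : Matrix p q ℝ) :
    ⟪X, Aᵀ * A⟫_ℝ = ∑ i, A i ⬝ᵥ X *ᵥ A i := by
  have hsum : Aᵀ * A = ∑ i, Matrix.vecMulVec (A i) (A i) := by
    ext a b
    simp [Matrix.mul_apply, Matrix.sum_apply, Matrix.vecMulVec_apply]
  rw [hsum, inner_sum]
  exact Finset.sum_congr rfl fun i _ => inner_vecMulVec X (A i) (A i)

lemma nonneg_of_forall_pos_lt_mul {a b : ℝ} (h : ∀ t > 0, a < t * b) : 0 ≤ b := by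
  by_contra! hb
  have h' := h ((|a| + 1) / -b) (div_pos (by positivity) (neg_pos.2 hb))
  rw [div_neg, neg_mul, div_mul_cancel₀ _ hb.ne] at h'
  linarith [neg_abs_le a]

lemma nonpos_of_forall_pos_lt_mul {a b : ℝ} (h : ∀ t > 0, a < t * b) : a ≤ 0 := by
  have hcont : Continuous fun t : ℝ => t * b := by fun_prop
  have hlim : Tendsto (fun t : ℝ => t * b) (𝓝[>] 0) (𝓝 0) := by
    simpa using (hcont.tendsto 0).mono_left nhdsWithin_le_nhds
  exact ge_of_tendsto hlim (eventually_mem_nhdsWithin.mono fun t ht => (h t ht).le)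

lemma smul_mem_posQuad_add_nonnegCone {V : Matrix p p ℝ} (hV : V ∈ posQuad p + nonnegCone p p)
    {c : ℝ} (hc : 0 < c) : c • V ∈ posQuad p + nonnegCone p p := by
  obtain ⟨W, hW, μ, hμ, rfl⟩ := hV
  rw [smul_add]
  exact Set.add_mem_add (smul_mem_posQuad hW hc) fun i j => mul_nonneg hc.le (hμ i j)

lemma eq_zero_of_inner_transpose_mul_self_nonpos {r : Type*} [Fintype r] {A : Matrix r p ℝ}
    (hA : ∀ x : p → ℝ, (∀ j, 0 ≤ x j) → A *ᵥ x = 0 → x = 0) {X : Matrix p p ℝ}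
    (hX : X.PosSemidef) (hX₀ : X ∈ nonnegCone p p) (hXA : ⟪X, Aᵀ * A⟫_ℝ ≤ 0) : X = 0 := by
  have hnonneg (i : r) : 0 ≤ A i ⬝ᵥ X *ᵥ A i := hX.dotProduct_mulVec_nonneg (A i)
  rw [inner_transpose_mul_self] at hXA
  have hker (i : r) : X *ᵥ A i = 0 :=
    (hX.dotProduct_mulVec_zero_iff (A i)).1 <|
      (Finset.sum_eq_zero_iff_of_nonneg fun i _ => hnonneg i).1
        (hXA.antisymm (Finset.sum_nonneg fun i _ => hnonneg i)) i (Finset.mem_univ i)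
  have hrow (j : p) : X j = 0 := hA (X j) (hX₀ j) <| funext fun i => by
    rw [Matrix.mulVec, dotProduct_comm]
    exact congrFun (hker i) j
  exact funext hrow

lemma posSemidef_of_forall_inner_nonneg {X : Matrix p p ℝ}
    (hX : ∀ V : Matrix p p ℝ, (∀ x : p → ℝ, 0 ≤ x ⬝ᵥ V *ᵥ x) → 0 ≤ ⟪X, V⟫_ℝ) :
    X.PosSemidef := by
  classical
  refine posSemidef_iff_isSymm_and_dotProduct_mulVec_nonneg.2 ⟨?_, fun x => ?_⟩
  · -- The quadratic form of `single j i 1 - single i j 1` vanishes.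
    have hle (i j : p) : X i j ≤ X j i := by
      have h := hX (Matrix.single j i 1 - Matrix.single i j 1) fun x => by
        rw [Matrix.sub_mulVec, dotProduct_sub]
        simp [Matrix.single_mulVec, dotProduct, Function.update_apply, mul_comm]
      rwa [inner_sub_right, inner_single, inner_single, mul_one, mul_one, sub_nonneg] at h
    ext i j
    exact le_antisymm (hle j i) (hle i j)
  · rw [← inner_vecMulVec]
    refine hX _ fun y => ?_
    rw [Matrix.vecMulVec_mulVec, dotProduct_smul, MulOpposite.smul_eq_mul_unop,
      MulOpposite.unop_op, dotProduct_comm y]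
    exact mul_self_nonneg _

-- A hyperplane separating `W` from the open convex cone `posQuad p + nonnegCone p p` is normal to
-- an element of the dual cone, the doubly nonnegative matrices.
lemma exists_posSemidef_inner_nonpos {W : Matrix p p ℝ} (hW : W ∉ posQuad p + nonnegCone p p) :
    ∃ X : Matrix p p ℝ, X.PosSemidef ∧ X ∈ nonnegCone p p ∧ X ≠ 0 ∧ ⟪X, W⟫_ℝ ≤ 0 := by
  classical
  set T := posQuad p + nonnegCone p p
  obtain ⟨f, hf⟩ := geometric_hahn_banach_point_open (convex_posQuad.add (convex_nonnegCone p p))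
    isOpen_posQuad.add_right hW
  set X := (InnerProductSpace.toDual ℝ (Matrix p p ℝ)).symm f
  have hX (V : Matrix p p ℝ) : f V = ⟪X, V⟫_ℝ := InnerProductSpace.toDual_symm_apply.symm
  simp only [hX] at hf
  have hray (V : Matrix p p ℝ) (hV : V ∈ T) (t : ℝ) (ht : 0 < t) : ⟪X, W⟫_ℝ < t * ⟪X, V⟫_ℝ := by
    rw [← inner_smul_right]
    exact hf _ (smul_mem_posQuad_add_nonnegCone hV ht)
  have hone : (1 : Matrix p p ℝ) ∈ T := by
    simpa using Set.add_mem_add one_mem_posQuad (show 0 ∈ nonnegCone p p from fun _ _ => le_rfl)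
  have hclosed : IsClosed {V : Matrix p p ℝ | 0 ≤ ⟪X, V⟫_ℝ} :=
    isClosed_le continuous_const (continuous_const.inner continuous_id)
  have hT : T ⊆ {V | 0 ≤ ⟪X, V⟫_ℝ} := fun V hV => nonneg_of_forall_pos_lt_mul (hray V hV)
  have hdual (V μ : Matrix p p ℝ) (hV : ∀ x : p → ℝ, 0 ≤ x ⬝ᵥ V *ᵥ x)
      (hμ : μ ∈ nonnegCone p p) : 0 ≤ ⟪X, V + μ⟫_ℝ :=
    closure_minimal hT hclosed <| map_mem_closure (f := (· + μ)) (by fun_prop)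
      (mem_closure_posQuad hV) fun V' hV' => Set.add_mem_add hV' hμ
  refine ⟨X, posSemidef_of_forall_inner_nonneg fun V hV => ?_, fun i j => ?_, ?_,
    nonpos_of_forall_pos_lt_mul (hray 1 hone)⟩
  · simpa using hdual V 0 hV fun _ _ => le_rfl
  · have h := hdual 0 (Matrix.single i j 1) (by simp) fun a b => by
      rw [Matrix.single_apply]
      split_ifs <;> simp
    rwa [zero_add, inner_single, mul_one] at h
  · intro hX0
    simpa [hX0] using hf 1 hone

lemma smul_transpose_mul_self_mem_posQuad_add_nonnegCone {r : Type*} [Fintype r]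
    {A : Matrix r p ℝ} (hA : ∀ x : p → ℝ, (∀ j, 0 ≤ x j) → A *ᵥ x = 0 → x = 0) {γ : ℝ}
    (hγ : 0 < γ) : γ • (Aᵀ * A) ∈ posQuad p + nonnegCone p p := by
  by_contra hmem
  obtain ⟨X, hX, hX₀, hne, hXA⟩ := exists_posSemidef_inner_nonpos hmem
  rw [inner_smul_right] at hXA
  exact hne (eq_zero_of_inner_transpose_mul_self_nonpos hA hX hX₀
    (nonpos_of_mul_nonpos_right hXA hγ))

end DoublyNonnegative

section Blocks

lemma inner_eq_sum_inner_toBlocks {l o p q : Type*} [Fintype l] [Fintype o] [Fintype p] [Fintype q]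
    (X Y : Matrix (l ⊕ o) (p ⊕ q) ℝ) :
    ⟪X, Y⟫_ℝ = ⟪X.toBlocks₁₁, Y.toBlocks₁₁⟫_ℝ + ⟪X.toBlocks₁₂, Y.toBlocks₁₂⟫_ℝ
      + ⟪X.toBlocks₂₁, Y.toBlocks₂₁⟫_ℝ + ⟪X.toBlocks₂₂, Y.toBlocks₂₂⟫_ℝ := by
  simp only [inner_eq_sum, Fintype.sum_sum_type, Finset.sum_add_distrib, Matrix.toBlocks₁₁,
    Matrix.toBlocks₁₂, Matrix.toBlocks₂₁, Matrix.toBlocks₂₂, Matrix.of_apply]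
  ring

lemma isSymm_transpose_mul_self {p q : Type*} [Fintype p] (X : Matrix p q ℝ) :
    (Xᵀ * X).IsSymm := by
  rw [Matrix.IsSymm, Matrix.transpose_mul, Matrix.transpose_transpose]

variable {m n : ℕ} (A : Matrix (Fin m) (Fin n) ℝ) (γ : ℝ) (L S : Matrix (Fin m) (Fin n) ℝ)
  (μ : Matrix (Fin n) (Fin n) ℝ)

lemma inner_opG (Q : Matrix (Fin m ⊕ Fin n) (Fin m ⊕ Fin n) ℝ) :
    ⟪Q, opG L S μ⟫_ℝ = ⟪Q.toBlocks₁₂ + Q.toBlocks₂₁ᵀ, L + S⟫_ℝ - ⟪Q.toBlocks₂₂, μ⟫_ℝ := by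
  rw [inner_eq_sum_inner_toBlocks, opG, Matrix.toBlocks_fromBlocks₁₁,
    Matrix.toBlocks_fromBlocks₁₂, Matrix.toBlocks_fromBlocks₂₁, Matrix.toBlocks_fromBlocks₂₂,
    inner_zero_right, zero_add, inner_neg_right, ← sub_eq_add_neg, inner_add_left,
    ← inner_transpose Q.toBlocks₂₁, Matrix.transpose_transpose]

lemma norm_opG_sq : ‖opG L S μ‖ ^ 2 = 2 * ‖L + S‖ ^ 2 + ‖μ‖ ^ 2 := by
  rw [← real_inner_self_eq_norm_sq, inner_opG, opG, Matrix.toBlocks_fromBlocks₁₂,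
    Matrix.toBlocks_fromBlocks₂₁, Matrix.toBlocks_fromBlocks₂₂, Matrix.transpose_transpose,
    inner_add_left, inner_neg_left, real_inner_self_eq_norm_sq, real_inner_self_eq_norm_sq]
  ring

lemma norm_opG_sq_le : ‖opG L S μ‖ ^ 2 ≤ 2 ^ 2 * (‖L‖ ^ 2 + ‖S‖ ^ 2 + ‖μ‖ ^ 2) := by
  have hpar := parallelogram_law_with_norm ℝ L S
  rw [norm_opG_sq]
  nlinarith [sq_nonneg ‖L - S‖, sq_nonneg ‖μ‖]

theorem isLUB_frobNorm_opG (hm : 0 < m) (hn : 0 < n) :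
    IsLUB {r : ℝ | ∃ (L S : Matrix (Fin m) (Fin n) ℝ) (μ : Matrix (Fin n) (Fin n) ℝ),
      frobNorm L ^ 2 + frobNorm S ^ 2 + frobNorm μ ^ 2 = 1 ∧ r = frobNorm (opG L S μ)} 2 := by
  simp only [← norm_eq_frobNorm]
  refine IsGreatest.isLUB ⟨?_, ?_⟩
  · set E : Matrix (Fin m) (Fin n) ℝ := Matrix.single ⟨0, hm⟩ ⟨0, hn⟩ √2⁻¹
    have hE : ‖E‖ ^ 2 = 2⁻¹ := by
      simp [norm_sq_eq_sum, E, Matrix.single_apply, ite_and]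
    refine ⟨E, E, 0, by rw [hE, norm_zero]; norm_num, ?_⟩
    rw [← sq_eq_sq₀ zero_le_two (norm_nonneg _), norm_opG_sq, ← two_smul ℝ E, norm_smul, mul_pow,
      hE, norm_zero]
    norm_num
  · rintro _ ⟨L, S, μ, hnorm, rfl⟩
    have hle := norm_opG_sq_le L S μ
    rw [hnorm, mul_one] at hle
    exact le_of_sq_le_sq hle zero_le_two

lemma opG_add_blockMat_zero : opG L S μ + blockMat A γ 0 0 0 = blockMat A γ L S μ := by
  rw [opG, blockMat, blockMat, Matrix.fromBlocks_add, zero_add, zero_add, zero_sub, sub_zero,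
    ← Matrix.transpose_add, ← sub_eq_add_neg, neg_add_eq_sub]

lemma sub_opG_sub_blockMat_zero (Z : Matrix (Fin m ⊕ Fin n) (Fin m ⊕ Fin n) ℝ) :
    Z - opG L S μ - blockMat A γ 0 0 0 = Z - blockMat A γ L S μ := by
  rw [sub_sub, opG_add_blockMat_zero]

variable {μ} in
lemma isSymm_blockMat (hμ : μ.IsSymm) : (blockMat A γ L S μ).IsSymm :=
  Matrix.IsSymm.fromBlocks Matrix.isSymm_one rfl
    (((isSymm_transpose_mul_self A).smul γ).sub hμ)

lemma dotProduct_blockMat_mulVec (x : Fin m ⊕ Fin n → ℝ) :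
    x ⬝ᵥ blockMat A γ L S μ *ᵥ x
      = (x ∘ Sum.inl) ⬝ᵥ (x ∘ Sum.inl) + 2 * ((x ∘ Sum.inl) ⬝ᵥ (L + S - A) *ᵥ (x ∘ Sum.inr))
        + (x ∘ Sum.inr) ⬝ᵥ (γ • (Aᵀ * A) - μ) *ᵥ (x ∘ Sum.inr) := by
  rw [blockMat, Matrix.fromBlocks_mulVec]
  conv_lhs => rw [← Sum.elim_comp_inl_inr x]
  rw [sumElim_dotProduct_sumElim, Sum.elim_comp_inl, Sum.elim_comp_inr, dotProduct_add,
    dotProduct_add, Matrix.one_mulVec, Matrix.dotProduct_mulVec (x ∘ Sum.inr) (Matrix.transpose _),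
    Matrix.vecMul_transpose, dotProduct_comm ((L + S - A) *ᵥ _)]
  ring

end Blocks

section ConeProgram

variable {m n : ℕ}

lemma isClosed_posSemidef {p : Type*} [Finite p] :
    IsClosed {W : Matrix p p ℝ | W.PosSemidef} := by
  cases nonempty_fintype p
  simp only [posSemidef_iff_isSymm_and_dotProduct_mulVec_nonneg, Set.ofPred_and, Set.ofPred_forall]
  exact IsClosed.inter (isClosed_eq (by fun_prop) continuous_id)
    (isClosed_iInter fun x => isClosed_le continuous_const (by fun_prop))

lemma convex_posSemidef {p : Type*} :
    Convex ℝ {W : Matrix p p ℝ | W.PosSemidef} :=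
  fun _ hV _ hW _ _ ha hb _ => (hV.smul ha).add (hW.smul hb)

/-- The space of the unknowns `(L, S, μ)`, with the norm `(‖L‖² + ‖S‖² + ‖μ‖²)^(1/2)`. -/
abbrev Unknowns (m n : ℕ) : Type :=
  WithLp 2 (Matrix (Fin m) (Fin n) ℝ ×
    WithLp 2 (Matrix (Fin m) (Fin n) ℝ × Matrix (Fin n) (Fin n) ℝ))

/-- The point of `Unknowns m n` with components `L`, `S` and `μ`. -/
abbrev Unknowns.mk (L S : Matrix (Fin m) (Fin n) ℝ) (μ : Matrix (Fin n) (Fin n) ℝ) :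
    Unknowns m n :=
  WithLp.toLp 2 (L, WithLp.toLp 2 (S, μ))

lemma Unknowns.norm_sq (u : Unknowns m n) :
    ‖u‖ ^ 2 = ‖u.fst‖ ^ 2 + ‖u.snd.fst‖ ^ 2 + ‖u.snd.snd‖ ^ 2 := by
  rw [WithLp.prod_norm_sq_eq_of_L2, WithLp.prod_norm_sq_eq_of_L2, add_assoc]

lemma Unknowns.inner_eq (u v : Unknowns m n) :
    ⟪u, v⟫_ℝ = ⟪u.fst, v.fst⟫_ℝ + ⟪u.snd.fst, v.snd.fst⟫_ℝ + ⟪u.snd.snd, v.snd.snd⟫_ℝ := by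
  rw [WithLp.prod_inner_apply, WithLp.prod_inner_apply, add_assoc]
  rfl

/-- The operator `𝒢` as a linear map. -/
def opGLinearMap (m n : ℕ) : Unknowns m n →ₗ[ℝ] Matrix (Fin m ⊕ Fin n) (Fin m ⊕ Fin n) ℝ where
  toFun u := opG u.fst u.snd.fst u.snd.snd
  map_add' u v := by
    simp only [WithLp.add_fst, WithLp.add_snd, opG, Matrix.fromBlocks_add, ← Matrix.transpose_add,
      add_zero, neg_add, add_add_add_comm]
  map_smul' a u := by
    simp only [WithLp.smul_fst, WithLp.smul_snd, opG, Matrix.fromBlocks_smul, Matrix.transpose_smul,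
      smul_zero, smul_neg, smul_add, RingHom.id_apply, Matrix.transpose_add]

lemma norm_opGLinearMap_le (u : Unknowns m n) : ‖opGLinearMap m n u‖ ≤ 2 * ‖u‖ := by
  refine abs_le_of_sq_le_sq' ?_ (by positivity) |>.2
  rw [mul_pow, Unknowns.norm_sq]
  exact norm_opG_sq_le _ _ _

/-- The cone-preserving decomposition problem as a split program in the unknowns `(L, S, μ)`. -/
def coneProgram (A : Matrix (Fin m) (Fin n) ℝ) (γ lam : ℝ) :
    SplitProgram (Matrix (Fin m ⊕ Fin n) (Fin m ⊕ Fin n) ℝ) (Unknowns m n) where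
  K := {Z | Z.PosSemidef}
  C := {u | u.snd.snd ∈ nonnegCone (Fin n) (Fin n)}
  φ u := objective lam u.fst u.snd.fst
  G := (opGLinearMap m n).mkContinuous 2 norm_opGLinearMap_le
  c := blockMat A γ 0 0 0

variable (A : Matrix (Fin m) (Fin n) ℝ) {γ lam : ℝ}

lemma norm_coneProgram_G_le (γ lam : ℝ) : ‖(coneProgram A γ lam).G‖ ≤ 2 :=
  LinearMap.mkContinuous_norm_le _ zero_le_two norm_opGLinearMap_le

lemma sqrt_mul_norm_coneProgram_G_le (γ lam : ℝ) {τ : ℝ} (hτ : τ ≤ 1 / 4) :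
    √τ * ‖(coneProgram A γ lam).G‖ ≤ 1 := by
  have hsqrt : √τ ≤ 1 / 2 := Real.sqrt_le_iff.2 ⟨by norm_num, by linarith⟩
  nlinarith [norm_coneProgram_G_le A γ lam, Real.sqrt_nonneg τ]

lemma sqrt_mul_norm_coneProgram_G_lt (γ lam : ℝ) {τ : ℝ} (hτ : τ < 1 / 4) :
    √τ * ‖(coneProgram A γ lam).G‖ < 1 := by
  have hsqrt : √τ < 1 / 2 := (Real.sqrt_lt' (by norm_num)).2 (by linarith)
  nlinarith [norm_coneProgram_G_le A γ lam, Real.sqrt_nonneg τ]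

lemma adjoint_coneProgram_G_apply (γ lam : ℝ) (Q : Matrix (Fin m ⊕ Fin n) (Fin m ⊕ Fin n) ℝ) :
    ((coneProgram A γ lam).G†) Q = Unknowns.mk (Q.toBlocks₁₂ + Q.toBlocks₂₁ᵀ)
      (Q.toBlocks₁₂ + Q.toBlocks₂₁ᵀ) (-Q.toBlocks₂₂) := by
  refine ext_inner_right ℝ fun u => ?_
  rw [ContinuousLinearMap.adjoint_inner_left, Unknowns.inner_eq]
  refine (inner_opG u.fst u.snd.fst u.snd.snd Q).trans ?_
  rw [inner_add_right, sub_eq_add_neg, ← inner_neg_left]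
  rfl

lemma coneProgram_map_add (γ lam : ℝ) (u : Unknowns m n) :
    (coneProgram A γ lam).G u + (coneProgram A γ lam).c
      = blockMat A γ u.fst u.snd.fst u.snd.snd :=
  opG_add_blockMat_zero A γ _ _ _

lemma coneProgram_residual (γ lam : ℝ) (Z : Matrix (Fin m ⊕ Fin n) (Fin m ⊕ Fin n) ℝ)
    (u : Unknowns m n) :
    (coneProgram A γ lam).residual Z u = Z - blockMat A γ u.fst u.snd.fst u.snd.snd :=
  sub_opG_sub_blockMat_zero A γ _ _ _ Z

lemma coneProgram_lagrangian (γ lam : ℝ) (Z Y : Matrix (Fin m ⊕ Fin n) (Fin m ⊕ Fin n) ℝ)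
    (u : Unknowns m n) : (coneProgram A γ lam).lagrangian Z u Y
      = lagrangian A γ lam Z u.fst u.snd.fst u.snd.snd Y := by
  rw [SplitProgram.lagrangian, coneProgram_residual, inner_eq_sum]
  rfl

lemma isOptimal_of_isSaddle {A : Matrix (Fin m) (Fin n) ℝ} {u : Unknowns m n}
    {Q : Matrix (Fin m ⊕ Fin n) (Fin m ⊕ Fin n) ℝ} (hs : (coneProgram A γ lam).IsSaddle u Q) :
    IsOptimal A γ lam (blockMat A γ u.fst u.snd.fst u.snd.snd) u.fst u.snd.fst u.snd.snd := by
  refine ⟨⟨coneProgram_map_add A γ lam u ▸ hs.mem_K, hs.mem_C, sub_self _⟩, ?_⟩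
  rintro Z L S μ ⟨hZ, hμ, hfeas⟩
  calc objective lam u.fst u.snd.fst
      ≤ (coneProgram A γ lam).lagrangian Z (Unknowns.mk L S μ) Q := hs.le_lagrangian Z hZ _ hμ
    _ = objective lam L S + ⟪Q, Z - blockMat A γ L S μ⟫_ℝ := by
        rw [SplitProgram.lagrangian, coneProgram_residual]
        rfl
    _ = objective lam L S := by rw [hfeas, inner_zero_right, add_zero]

lemma continuous_objective (lam : ℝ) :
    Continuous fun u : Unknowns m n => objective lam u.fst u.snd.fst :=
  (continuous_nuclearNorm.comp (by fun_prop)).add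
    ((continuous_l1Norm.comp (by fun_prop)).const_mul lam)

lemma isClosed_coneProgram_C (γ lam : ℝ) : IsClosed (coneProgram A γ lam).C :=
  (isClosed_nonnegCone (Fin n) (Fin n)).preimage
    (show Continuous fun u : Unknowns m n => u.snd.snd by fun_prop)

lemma convexOn_coneProgram_φ (γ : ℝ) (hlam : 0 ≤ lam) :
    ConvexOn ℝ (coneProgram A γ lam).C (coneProgram A γ lam).φ := by
  refine ⟨fun u hu v hv a b ha hb hab => convex_nonnegCone _ _ hu hv ha hb hab,
    fun u _ v _ a b ha hb hab => ?_⟩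
  have hL := convexOn_nuclearNorm.2 (Set.mem_univ u.fst) (Set.mem_univ v.fst) ha hb hab
  have hS := convexOn_l1Norm.2 (Set.mem_univ u.snd.fst) (Set.mem_univ v.snd.fst) ha hb hab
  simp only [coneProgram, objective, smul_eq_mul, WithLp.add_fst, WithLp.add_snd, WithLp.smul_fst,
    WithLp.smul_snd] at hL hS ⊢
  linarith [mul_le_mul_of_nonneg_left hS hlam]

lemma sum_le_of_posSemidef_blockMat {A L S : Matrix (Fin m) (Fin n) ℝ} {γ : ℝ}
    {μ : Matrix (Fin n) (Fin n) ℝ} (h : (blockMat A γ L S μ).PosSemidef) :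
    ∑ i, ∑ j, μ i j ≤ ∑ i, ∑ j, (γ • (Aᵀ * A)) i j := by
  have hsum (W : Matrix (Fin n) (Fin n) ℝ) : 1 ⬝ᵥ W *ᵥ 1 = ∑ i, ∑ j, W i j := by
    simp [dotProduct, Matrix.mulVec]
  have hquad := (posSemidef_iff_isSymm_and_dotProduct_mulVec_nonneg.1 h).2 (Sum.elim 0 1)
  simp only [dotProduct_blockMat_mulVec, Sum.elim_comp_inl, Sum.elim_comp_inr, zero_dotProduct,
    Matrix.sub_mulVec, dotProduct_sub, hsum, sub_self, mul_zero, zero_add] at hquad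
  exact sub_nonneg.1 hquad

lemma l1Norm_eq_sum_of_mem_nonnegCone {X : Matrix (Fin m) (Fin n) ℝ}
    (hX : X ∈ nonnegCone (Fin m) (Fin n)) : l1Norm X = ∑ i, ∑ j, X i j := by
  simp only [l1Norm, abs_of_nonneg (hX _ _)]

lemma posSemidef_blockMat_self_zero_zero (A : Matrix (Fin m) (Fin n) ℝ) {γ : ℝ} (hγ : 0 ≤ γ) :
    (blockMat A γ A 0 0).PosSemidef := by
  have hgram : (Aᵀ * A).PosSemidef := by
    simpa using Matrix.posSemidef_conjTranspose_mul_self A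
  refine posSemidef_iff_isSymm_and_dotProduct_mulVec_nonneg.2
    ⟨isSymm_blockMat A γ A 0 Matrix.isSymm_zero, fun x => ?_⟩
  rw [dotProduct_blockMat_mulVec, add_zero, sub_self, sub_zero, Matrix.zero_mulVec,
    dotProduct_zero, mul_zero, add_zero]
  exact add_nonneg (Finset.sum_nonneg fun i _ => mul_self_nonneg _)
    ((hgram.smul hγ).dotProduct_mulVec_nonneg _)

/-- The feasible unknowns whose objective value is at most `r`. -/
def feasibleSublevel (A : Matrix (Fin m) (Fin n) ℝ) (γ lam r : ℝ) : Set (Unknowns m n) :=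
  {u | u.snd.snd ∈ nonnegCone (Fin n) (Fin n) ∧
    (blockMat A γ u.fst u.snd.fst u.snd.snd).PosSemidef ∧ objective lam u.fst u.snd.fst ≤ r}

lemma isClosed_feasibleSublevel (γ lam r : ℝ) : IsClosed (feasibleSublevel A γ lam r) := by
  have hblock : Continuous fun u : Unknowns m n => blockMat A γ u.fst u.snd.fst u.snd.snd := by
    unfold blockMat
    exact Continuous.matrix_fromBlocks (by fun_prop) (by fun_prop) (by fun_prop) (by fun_prop)
  exact (isClosed_coneProgram_C A γ lam).inter ((isClosed_posSemidef.preimage hblock).inter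
    (isClosed_le (continuous_objective lam) continuous_const))

lemma isBounded_feasibleSublevel (γ r : ℝ) (hlam : 0 < lam) :
    Bornology.IsBounded (feasibleSublevel A γ lam r) := by
  set M := ∑ i, ∑ j, (γ • (Aᵀ * A)) i j
  refine isBounded_iff_forall_norm_le.2 ⟨√(r ^ 2 + (r / lam) ^ 2 + M ^ 2), ?_⟩
  rintro u ⟨hμ, hpsd, hr⟩
  have hL := norm_le_nuclearNorm u.fst
  have hS := norm_le_l1Norm u.snd.fst
  have hμ' : ‖u.snd.snd‖ ≤ M :=
    (norm_le_l1Norm _).trans ((l1Norm_eq_sum_of_mem_nonnegCone hμ).trans_le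
      (sum_le_of_posSemidef_blockMat hpsd))
  have hL' : ‖u.fst‖ ≤ r := by
    unfold objective at hr
    nlinarith [norm_nonneg u.snd.fst]
  have hS' : ‖u.snd.fst‖ ≤ r / lam := by
    unfold objective at hr
    rw [le_div_iff₀ hlam]
    nlinarith [norm_nonneg u.fst]
  refine Real.le_sqrt_of_sq_le ?_
  rw [Unknowns.norm_sq]
  gcongr

lemma exists_optimal_unknowns (hγ : 0 ≤ γ) (hlam : 0 < lam) :
    ∃ u : Unknowns m n, u.snd.snd ∈ nonnegCone (Fin n) (Fin n) ∧
      (blockMat A γ u.fst u.snd.fst u.snd.snd).PosSemidef ∧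
      ∀ L S, ∀ μ ∈ nonnegCone (Fin n) (Fin n), (blockMat A γ L S μ).PosSemidef →
        objective lam u.fst u.snd.fst ≤ objective lam L S := by
  let r := objective lam A 0
  have hmem : Unknowns.mk A 0 0 ∈ feasibleSublevel A γ lam r :=
    ⟨fun _ _ => le_rfl, posSemidef_blockMat_self_zero_zero A hγ, le_rfl⟩
  have hcompact : IsCompact (feasibleSublevel A γ lam r) :=
    Metric.isCompact_of_isClosed_isBounded (isClosed_feasibleSublevel A γ lam r)
      (isBounded_feasibleSublevel A γ r hlam)
  have hcont : ContinuousOn (fun u : Unknowns m n => objective lam u.fst u.snd.fst)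
      (feasibleSublevel A γ lam r) := (continuous_objective lam).continuousOn
  obtain ⟨u, ⟨hμ, hpsd, hr⟩, hmin⟩ := hcompact.exists_isMinOn ⟨_, hmem⟩ hcont
  refine ⟨u, hμ, hpsd, fun L S μ hμ' hpsd' => ?_⟩
  rcases le_total (objective lam L S) r with h | h
  · exact isMinOn_iff.1 hmin (Unknowns.mk L S μ) ⟨hμ', hpsd', h⟩
  · exact hr.trans h

lemma dotProduct_transpose_mulVec_self {p : Type*} [Fintype p] (W : Matrix p p ℝ) (x : p → ℝ) :
    x ⬝ᵥ Wᵀ *ᵥ x = x ⬝ᵥ W *ᵥ x := by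
  rw [Matrix.dotProduct_mulVec, Matrix.vecMul_transpose, dotProduct_comm]

/-- Symmetrizing `μ` changes neither the quadratic form of the constraint matrix nor the
objective, so asymmetric `μ` do not lower the optimal value. -/
lemma le_objective_of_mem_posQuad {A : Matrix (Fin m) (Fin n) ℝ} {γ lam r : ℝ}
    (hr : ∀ L S, ∀ μ ∈ nonnegCone (Fin n) (Fin n), (blockMat A γ L S μ).PosSemidef →
      r ≤ objective lam L S)
    {L S : Matrix (Fin m) (Fin n) ℝ} {μ : Matrix (Fin n) (Fin n) ℝ}
    (hμ : μ ∈ nonnegCone (Fin n) (Fin n)) (hpos : blockMat A γ L S μ ∈ posQuad (Fin m ⊕ Fin n)) :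
    r ≤ objective lam L S := by
  set ν := (2⁻¹ : ℝ) • (μ + μᵀ)
  have hν : ν.IsSymm := (Matrix.isSymm_add_transpose_self μ).smul _
  have hquad (x : Fin n → ℝ) : x ⬝ᵥ ν *ᵥ x = x ⬝ᵥ μ *ᵥ x := by
    rw [Matrix.smul_mulVec, dotProduct_smul, Matrix.add_mulVec, dotProduct_add,
      dotProduct_transpose_mulVec_self, ← two_smul ℝ, inv_smul_smul₀ two_ne_zero]
  refine hr L S ν (fun i j => mul_nonneg (by norm_num) (add_nonneg (hμ i j) (hμ j i)))
    (posSemidef_iff_isSymm_and_dotProduct_mulVec_nonneg.2 ⟨isSymm_blockMat A γ L S hν, fun x => ?_⟩)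
  simpa only [dotProduct_blockMat_mulVec, Matrix.sub_mulVec, dotProduct_sub, hquad] using
    dotProduct_mulVec_nonneg_of_mem_posQuad hpos x

lemma blockMat_self_zero_mem_posQuad {A : Matrix (Fin m) (Fin n) ℝ} {γ : ℝ}
    {μ : Matrix (Fin n) (Fin n) ℝ} (h : γ • (Aᵀ * A) - μ ∈ posQuad (Fin n)) :
    blockMat A γ A 0 μ ∈ posQuad (Fin m ⊕ Fin n) := by
  intro x hx
  rw [dotProduct_blockMat_mulVec, add_zero, sub_self, Matrix.zero_mulVec, dotProduct_zero,
    mul_zero, add_zero]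
  have hnonneg : 0 ≤ (x ∘ Sum.inl) ⬝ᵥ (x ∘ Sum.inl) :=
    Finset.sum_nonneg fun i _ => mul_self_nonneg _
  rcases eq_or_ne (x ∘ Sum.inr) 0 with hr | hr
  · have hl : x ∘ Sum.inl ≠ 0 := fun hl => hx <| by
      rw [← Sum.elim_comp_inl_inr x, hl, hr, Sum.elim_zero_zero]
    rw [hr, zero_dotProduct, add_zero]
    exact hnonneg.lt_of_ne' (dotProduct_self_eq_zero.not.2 hl)
  · exact add_pos_of_nonneg_of_pos hnonneg (h _ hr)

theorem exists_isSaddle (hγ : 0 < γ) (hlam : 0 < lam)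
    (hA : ∀ x : Fin n → ℝ, (∀ j, 0 ≤ x j) → A *ᵥ x = 0 → x = 0) :
    ∃ u Q, (coneProgram A γ lam).IsSaddle u Q := by
  obtain ⟨u, hu, hpsd, hmin⟩ := exists_optimal_unknowns A hγ.le hlam
  obtain ⟨W, hW, μ, hμ, hWμ⟩ := smul_transpose_mul_self_mem_posQuad_add_nonnegCone hA hγ
  have hslater : blockMat A γ A 0 μ ∈ posQuad (Fin m ⊕ Fin n) :=
    blockMat_self_zero_mem_posQuad (eq_sub_of_add_eq hWμ ▸ hW)
  obtain ⟨Q, hQ⟩ := (coneProgram A γ lam).exists_multiplier isOpen_posQuad convex_posQuad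
    (convexOn_coneProgram_φ A γ hlam.le) (r := objective lam u.fst u.snd.fst)
    (fun v hv hpos => le_objective_of_mem_posQuad hmin hv (coneProgram_map_add A γ lam v ▸ hpos))
    (v₀ := Unknowns.mk A 0 μ) hμ (by rwa [coneProgram_map_add])
  refine ⟨u, Q, hu, by rwa [coneProgram_map_add], fun Z hZ v hv => hQ Z ?_ v hv⟩
  exact mem_closure_posQuad (posSemidef_iff_isSymm_and_dotProduct_mulVec_nonneg.1 hZ).2

end ConeProgram

section Iteration

variable {m n : ℕ}

lemma exists_step (A : Matrix (Fin m) (Fin n) ℝ) (γ lam ρ τ : ℝ)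
    (L S : Matrix (Fin m) (Fin n) ℝ) {μ : Matrix (Fin n) (Fin n) ℝ}
    {Y : Matrix (Fin m ⊕ Fin n) (Fin m ⊕ Fin n) ℝ} (hμ : μ.IsSymm) (hY : Y.IsSymm) :
    ∃ Z L' S' μ' Y', IsPosPart (blockMat A γ L S μ - ρ⁻¹ • Y) Z ∧
      IsSingularThreshold (τ / ρ) (L + (2 * τ) • incr A ρ Z L S Y) L' ∧
      S' = (S + (2 * τ) • incr A ρ Z L S Y).map (shrink (τ * lam / ρ)) ∧
      μ' = (μ - τ • (Z.toBlocks₂₂ - γ • (Aᵀ * A) + μ + ρ⁻¹ • Y.toBlocks₂₂)).map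
        (fun x => max x 0) ∧
      Y' = Y + ρ • (Z - blockMat A γ L' S' μ') ∧ μ'.IsSymm ∧ Y'.IsSymm := by
  obtain ⟨Z, hZ⟩ := exists_isPosPart ((isSymm_blockMat A γ L S hμ).sub (hY.smul ρ⁻¹))
  obtain ⟨L', hL'⟩ := exists_isSingularThreshold (τ / ρ) (L + (2 * τ) • incr A ρ Z L S Y)
  have hZsymm : Z.IsSymm := (posSemidef_iff_isSymm_and_dotProduct_mulVec_nonneg.1 hZ.posSemidef).1
  have hblock (W : Matrix (Fin m ⊕ Fin n) (Fin m ⊕ Fin n) ℝ) (hW : W.IsSymm) :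
      W.toBlocks₂₂.IsSymm := Matrix.IsSymm.ext fun i j => hW.apply _ _
  have hμ' : ((μ - τ • (Z.toBlocks₂₂ - γ • (Aᵀ * A) + μ + ρ⁻¹ • Y.toBlocks₂₂)).map
      (fun x => max x 0)).IsSymm :=
    (hμ.sub (((((hblock Z hZsymm).sub ((isSymm_transpose_mul_self A).smul γ)).add hμ).add
      ((hblock Y hY).smul ρ⁻¹)).smul τ)).map _
  exact ⟨Z, L', _, _, _, hZ, hL', rfl, rfl, rfl, hμ',
    hY.add ((hZsymm.sub (isSymm_blockMat A γ _ _ hμ')).smul ρ)⟩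

theorem exists_isLADMM (A : Matrix (Fin m) (Fin n) ℝ) (γ lam ρ τ : ℝ)
    (Z₀ : Matrix (Fin m ⊕ Fin n) (Fin m ⊕ Fin n) ℝ) (L₀ S₀ : Matrix (Fin m) (Fin n) ℝ)
    (μ₀ : Matrix (Fin n) (Fin n) ℝ) (Y₀ : Matrix (Fin m ⊕ Fin n) (Fin m ⊕ Fin n) ℝ)
    (hμ₀ : μ₀.IsSymm) (hY₀ : Y₀.IsSymm) :
    ∃ Z L S μ Y, IsLADMM A γ lam ρ τ Z L S μ Y ∧
      Z 0 = Z₀ ∧ L 0 = L₀ ∧ S 0 = S₀ ∧ μ 0 = μ₀ ∧ Y 0 = Y₀ := by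
  let State := {s : Matrix (Fin m ⊕ Fin n) (Fin m ⊕ Fin n) ℝ × Matrix (Fin m) (Fin n) ℝ ×
    Matrix (Fin m) (Fin n) ℝ × Matrix (Fin n) (Fin n) ℝ ×
    Matrix (Fin m ⊕ Fin n) (Fin m ⊕ Fin n) ℝ // s.2.2.2.1.IsSymm ∧ s.2.2.2.2.IsSymm}
  choose Z L S μ Y hZ hL hS hμ hY hμsymm hYsymm using
    fun s : State => exists_step A γ lam ρ τ s.1.2.1 s.1.2.2.1 s.2.1 s.2.2
  let next : State → State := fun s => ⟨(Z s, L s, S s, μ s, Y s), hμsymm s, hYsymm s⟩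
  let state : ℕ → State := fun k => next^[k] ⟨(Z₀, L₀, S₀, μ₀, Y₀), hμ₀, hY₀⟩
  have state_succ (k : ℕ) : state (k + 1) = next (state k) := Function.iterate_succ_apply' _ _ _
  refine ⟨fun k => (state k).1.1, fun k => (state k).1.2.1, fun k => (state k).1.2.2.1,
    fun k => (state k).1.2.2.2.1, fun k => (state k).1.2.2.2.2, ?_, rfl, rfl, rfl, rfl, rfl⟩
  constructor <;> intro k <;> rw [state_succ]
  exacts [hZ _, hL _, hS _, hμ _, hY _]

/-- The multiplier `Y + ρ (Z - M(L, S, μ))` predicted from the new `Z` and the old unknowns. -/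
def predictedMultiplier (A : Matrix (Fin m) (Fin n) ℝ) (γ ρ : ℝ)
    (Z : Matrix (Fin m ⊕ Fin n) (Fin m ⊕ Fin n) ℝ) (L S : Matrix (Fin m) (Fin n) ℝ)
    (μ : Matrix (Fin n) (Fin n) ℝ) (Y : Matrix (Fin m ⊕ Fin n) (Fin m ⊕ Fin n) ℝ) :
    Matrix (Fin m ⊕ Fin n) (Fin m ⊕ Fin n) ℝ :=
  Y + ρ • (Z - blockMat A γ L S μ)

section Step

variable (A L S : Matrix (Fin m) (Fin n) ℝ) (γ : ℝ) {ρ : ℝ} (μ : Matrix (Fin n) (Fin n) ℝ)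
  (Z Y : Matrix (Fin m ⊕ Fin n) (Fin m ⊕ Fin n) ℝ)

lemma coneProgram_dualStep (lam ρ : ℝ) :
    (coneProgram A γ lam).dualStep ρ Z (Unknowns.mk L S μ) Y
      = predictedMultiplier A γ ρ Z L S μ Y := by
  rw [SplitProgram.dualStep, coneProgram_residual]
  rfl

lemma predictedMultiplier_eq_smul (hρ : ρ ≠ 0) :
    predictedMultiplier A γ ρ Z L S μ Y = ρ • (Z - (blockMat A γ L S μ - ρ⁻¹ • Y)) := by
  rw [predictedMultiplier, sub_sub_eq_add_sub, add_sub_right_comm, smul_add, smul_inv_smul₀ hρ,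
    add_comm]

lemma incr_eq_inv_smul_predictedMultiplier (hρ : ρ ≠ 0) :
    incr A ρ Z L S Y = ρ⁻¹ • (predictedMultiplier A γ ρ Z L S μ Y).toBlocks₁₂ := by
  ext i j
  simp only [incr, predictedMultiplier, blockMat, Matrix.toBlocks₁₂, Matrix.add_apply,
    Matrix.sub_apply, Matrix.smul_apply, Matrix.of_apply, Matrix.fromBlocks_apply₁₂, smul_eq_mul]
  field_simp
  ring

lemma sub_add_add_eq_inv_smul_predictedMultiplier (hρ : ρ ≠ 0) :
    Z.toBlocks₂₂ - γ • (Aᵀ * A) + μ + ρ⁻¹ • Y.toBlocks₂₂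
      = ρ⁻¹ • (predictedMultiplier A γ ρ Z L S μ Y).toBlocks₂₂ := by
  ext i j
  simp only [predictedMultiplier, blockMat, Matrix.toBlocks₂₂, Matrix.add_apply,
    Matrix.sub_apply, Matrix.smul_apply, Matrix.of_apply, Matrix.fromBlocks_apply₂₂, smul_eq_mul]
  field_simp
  ring

end Step

lemma cesaroMean_unknowns_mk (L S : ℕ → Matrix (Fin m) (Fin n) ℝ)
    (μ : ℕ → Matrix (Fin n) (Fin n) ℝ) (k : ℕ) :
    cesaroMean (fun j => Unknowns.mk (L (j + 1)) (S (j + 1)) (μ (j + 1))) k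
      = Unknowns.mk (avg L k) (avg S k) (avg μ k) := by
  rw [cesaroMean_toLp_mk, cesaroMean_toLp_mk]
  rfl

namespace IsLADMM

variable {A : Matrix (Fin m) (Fin n) ℝ} {γ lam ρ τ : ℝ}
  {Z : ℕ → Matrix (Fin m ⊕ Fin n) (Fin m ⊕ Fin n) ℝ}
  {L S : ℕ → Matrix (Fin m) (Fin n) ℝ} {μ : ℕ → Matrix (Fin n) (Fin n) ℝ}
  {Y : ℕ → Matrix (Fin m ⊕ Fin n) (Fin m ⊕ Fin n) ℝ}

lemma isSymm_predictedMultiplier (h : IsLADMM A γ lam ρ τ Z L S μ Y) (hρ : ρ ≠ 0) (k : ℕ) :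
    (predictedMultiplier A γ ρ (Z (k + 1)) (L k) (S k) (μ k) (Y k)).IsSymm := by
  have hZ := (posSemidef_iff_isSymm_and_dotProduct_mulVec_nonneg.1 (h.stepZ k).posSemidef).1
  rw [predictedMultiplier_eq_smul _ _ _ _ _ _ _ hρ]
  exact (hZ.sub (h.stepZ k).isSymm).smul ρ

/-- The factor `2` in the `L` and `S` updates is the sum of the two off-diagonal blocks in `𝒢*`,
which agree on symmetric multipliers. -/
lemma add_smul_incr_eq (h : IsLADMM A γ lam ρ τ Z L S μ Y) (hρ : ρ ≠ 0)
    (X : Matrix (Fin m) (Fin n) ℝ) (k : ℕ) :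
    X + (2 * τ) • incr A ρ (Z (k + 1)) (L k) (S k) (Y k) = X + (τ / ρ) •
      ((predictedMultiplier A γ ρ (Z (k + 1)) (L k) (S k) (μ k) (Y k)).toBlocks₁₂
        + (predictedMultiplier A γ ρ (Z (k + 1)) (L k) (S k) (μ k) (Y k)).toBlocks₂₁ᵀ) := by
  have hblocks : (predictedMultiplier A γ ρ (Z (k + 1)) (L k) (S k) (μ k) (Y k)).toBlocks₂₁ᵀ
      = (predictedMultiplier A γ ρ (Z (k + 1)) (L k) (S k) (μ k) (Y k)).toBlocks₁₂ :=
    Matrix.ext fun _ _ => (h.isSymm_predictedMultiplier hρ k).apply _ _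
  rw [hblocks, incr_eq_inv_smul_predictedMultiplier A (L k) (S k) γ (μ k) _ _ hρ, smul_smul,
    ← two_smul ℝ, smul_smul, show 2 * τ * ρ⁻¹ = τ / ρ * 2 by ring]

lemma isProxPoint_unknowns (h : IsLADMM A γ lam ρ τ Z L S μ Y) (hρ : 0 < ρ) (hτ : 0 < τ)
    (hlam : 0 ≤ lam) (k : ℕ) :
    IsProxPoint (coneProgram A γ lam).C ((τ / ρ) • (coneProgram A γ lam).φ)
      (Unknowns.mk (L k) (S k) (μ k) + (τ / ρ) • ((coneProgram A γ lam).G†)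
        (predictedMultiplier A γ ρ (Z (k + 1)) (L k) (S k) (μ k) (Y k)))
      (Unknowns.mk (L (k + 1)) (S (k + 1)) (μ (k + 1))) := by
  set Q := predictedMultiplier A γ ρ (Z (k + 1)) (L k) (S k) (μ k) (Y k)
  set t := τ / ρ
  have hL : IsProxPoint Set.univ (t • nuclearNorm)
      (L k + t • (Q.toBlocks₁₂ + Q.toBlocks₂₁ᵀ)) (L (k + 1)) :=
    h.add_smul_incr_eq hρ.ne' (L k) k ▸ (h.stepL k).isProxPoint (div_pos hτ hρ)
  have hS : IsProxPoint Set.univ ((τ * lam / ρ) • l1Norm)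
      (S k + t • (Q.toBlocks₁₂ + Q.toBlocks₂₁ᵀ)) (S (k + 1)) := by
    rw [h.stepS k, h.add_smul_incr_eq hρ.ne']
    exact isProxPoint_map_shrink (by positivity) _
  have hμ : IsProxPoint (nonnegCone (Fin n) (Fin n)) 0 (μ k + t • -Q.toBlocks₂₂) (μ (k + 1)) := by
    rw [h.stepμ k, sub_add_add_eq_inv_smul_predictedMultiplier A (L k) (S k) γ _ _ _ hρ.ne',
      smul_smul, ← div_eq_mul_inv, sub_eq_add_neg, ← smul_neg]
    exact isProxPoint_map_max_zero _
  have hprod := hL.prod (hS.prod hμ)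
  have hobjective (v : Unknowns m n) :
      (t • (coneProgram A γ lam).φ) v
        = (t • nuclearNorm) v.fst + (((τ * lam / ρ) • l1Norm) v.snd.fst + 0) := by
    simp only [coneProgram, objective, Pi.smul_apply, smul_eq_mul, t]
    ring
  rw [adjoint_coneProgram_G_apply]
  refine ⟨hprod.mem.2.2, fun v hv => ?_⟩
  rw [hobjective, hobjective]
  exact hprod.le v ⟨trivial, trivial, hv⟩

theorem isLinearizedADMM (h : IsLADMM A γ lam ρ τ Z L S μ Y) (hρ : 0 < ρ) (hτ : 0 < τ)
    (hlam : 0 ≤ lam) : IsLinearizedADMM (coneProgram A γ lam) ρ τ Z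
      (fun k => Unknowns.mk (L k) (S k) (μ k)) Y where
  proj k := by
    rw [coneProgram_map_add]
    exact (h.stepZ k).isProxPoint
  prox k := by
    rw [coneProgram_dualStep]
    exact h.isProxPoint_unknowns hρ hτ hlam k
  dual k := by
    rw [coneProgram_dualStep]
    exact h.stepY k

theorem lagrangian_gap_le (h : IsLADMM A γ lam ρ τ Z L S μ Y) (hlam : 0 ≤ lam) (hρ : 0 < ρ)
    (hτ : 0 < τ) (hτ' : τ ≤ 1 / 4) {k : ℕ} (hk : k ≠ 0)
    {Z' : Matrix (Fin m ⊕ Fin n) (Fin m ⊕ Fin n) ℝ} (L' S' : Matrix (Fin m) (Fin n) ℝ)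
    {μ' : Matrix (Fin n) (Fin n) ℝ} (Y' : Matrix (Fin m ⊕ Fin n) (Fin m ⊕ Fin n) ℝ)
    (hZ' : Z'.PosSemidef) (hμ' : ∀ i j, 0 ≤ μ' i j) :
    lagrangian A γ lam (avg Z k) (avg L k) (avg S k) (avg μ k) Y'
      - lagrangian A γ lam Z' L' S' μ' (avgPredictedY A γ ρ Z L S μ Y k)
    ≤ (ρ / τ * (frobNorm (L' - L 0) ^ 2 + frobNorm (S' - S 0) ^ 2 + frobNorm (μ' - μ 0) ^ 2)
        + 1 / ρ * frobNorm (Y' - Y 0) ^ 2) / (2 * k) := by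
  have hgap := (h.isLinearizedADMM hρ hτ hlam).ergodic_gap_le hρ hτ
    (sqrt_mul_norm_coneProgram_G_le A γ lam hτ') (convexOn_coneProgram_φ A γ hlam) hk hZ'
    (u := Unknowns.mk L' S' μ') hμ' Y'
  simp only [coneProgram_lagrangian, coneProgram_dualStep, cesaroMean_unknowns_mk, potential,
    Unknowns.norm_sq, norm_eq_frobNorm] at hgap
  refine hgap.trans_eq ?_
  field_simp
  rfl

theorem exists_optimal_limit (h : IsLADMM A γ lam ρ τ Z L S μ Y) (hγ : 0 < γ) (hlam : 0 < lam)
    (hρ : 0 < ρ) (hτ : 0 < τ) (hτ' : τ < 1 / 4)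
    (hA : ∀ x : Fin n → ℝ, (∀ j, 0 ≤ x j) → A *ᵥ x = 0 → x = 0) :
    ∃ Zs Ls Ss μs, IsOptimal A γ lam Zs Ls Ss μs ∧
      Tendsto Z atTop (𝓝 Zs) ∧ Tendsto L atTop (𝓝 Ls) ∧
      Tendsto S atTop (𝓝 Ss) ∧ Tendsto μ atTop (𝓝 μs) ∧
      ∃ C : ℝ, ∀ k : ℕ, 1 ≤ k →
        |objective lam (avg L k) (avg S k) - objective lam Ls Ss| ≤ C / k ∧
        frobNorm (avg Z k - blockMat A γ (avg L k) (avg S k) (avg μ k)) ≤ C / k := by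
  have hadmm := h.isLinearizedADMM hρ hτ hlam.le
  have hstep := sqrt_mul_norm_coneProgram_G_lt A γ lam hτ'
  obtain ⟨v, P, hsaddle⟩ := exists_isSaddle A hγ hlam hA
  obtain ⟨u, Q, hs, hu, hZ⟩ := hadmm.exists_tendsto hρ hτ hstep isClosed_posSemidef
    (isClosed_coneProgram_C A γ lam) (continuous_objective lam).continuousOn hsaddle
  obtain ⟨C, hC⟩ := hadmm.exists_ergodic_rate hρ hτ hstep.le (convexOn_coneProgram_φ A γ hlam.le)
    convex_posSemidef hs
  rw [coneProgram_map_add] at hZ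
  refine ⟨_, u.fst, u.snd.fst, u.snd.snd, isOptimal_of_isSaddle hs, hZ, ?_, ?_, ?_, C,
    fun k hk => ?_⟩
  · exact ((show Continuous fun u : Unknowns m n => u.fst by fun_prop).tendsto u).comp hu
  · exact ((show Continuous fun u : Unknowns m n => u.snd.fst by fun_prop).tendsto u).comp hu
  · exact ((show Continuous fun u : Unknowns m n => u.snd.snd by fun_prop).tendsto u).comp hu
  · have hrate := hC k (Nat.one_le_iff_ne_zero.1 hk)
    rwa [cesaroMean_unknowns_mk, coneProgram_residual, norm_eq_frobNorm] at hrate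

end IsLADMM

end Iteration

end

end ConePreserving

theorem mainTheorem12 {m n : ℕ} (A : Matrix (Fin m) (Fin n) ℝ) (γ lam ρ τ : ℝ)
    (hγ : 0 < γ) (hlam : 0 < lam) (hρ : 0 < ρ) (hτ : 0 < τ) (hτ' : τ < 0.25)
    -- the cone generated by the columns of `A` is pointed and no column is zero
    (hA : ∀ x : Fin n → ℝ, (∀ j, 0 ≤ x j) → A.mulVec x = 0 → x = 0) :
    -- the operator norm of `𝒢` is `2`
    (0 < m → 0 < n → IsLUB {r : ℝ | ∃ (L S : Matrix (Fin m) (Fin n) ℝ)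
        (μ : Matrix (Fin n) (Fin n) ℝ),
        ConePreserving.frobNorm L ^ 2 + ConePreserving.frobNorm S ^ 2
          + ConePreserving.frobNorm μ ^ 2 = 1 ∧
        r = ConePreserving.frobNorm (ConePreserving.opG L S μ)} 2) ∧
    -- the iteration can be run from any starting point
    (∀ (Z₀ : Matrix (Fin m ⊕ Fin n) (Fin m ⊕ Fin n) ℝ) (L₀ S₀ : Matrix (Fin m) (Fin n) ℝ)
      (μ₀ : Matrix (Fin n) (Fin n) ℝ) (Y₀ : Matrix (Fin m ⊕ Fin n) (Fin m ⊕ Fin n) ℝ),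
      μ₀.IsSymm → Y₀.IsSymm →
      ∃ Z L S μ Y, ConePreserving.IsLADMM A γ lam ρ τ Z L S μ Y ∧
        Z 0 = Z₀ ∧ L 0 = L₀ ∧ S 0 = S₀ ∧ μ 0 = μ₀ ∧ Y 0 = Y₀) ∧
    -- every run converges to an optimal solution, with rate `O(1/k)`
    (∀ Z L S μ Y, ConePreserving.IsLADMM A γ lam ρ τ Z L S μ Y →
      (∃ Zs Ls Ss μs, ConePreserving.IsOptimal A γ lam Zs Ls Ss μs ∧
        Tendsto Z atTop (𝓝 Zs) ∧ Tendsto L atTop (𝓝 Ls) ∧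
        Tendsto S atTop (𝓝 Ss) ∧ Tendsto μ atTop (𝓝 μs) ∧
        ∃ C : ℝ, ∀ k : ℕ, 1 ≤ k →
          |ConePreserving.objective lam (ConePreserving.avg L k) (ConePreserving.avg S k)
            - ConePreserving.objective lam Ls Ss| ≤ C / k ∧
          ConePreserving.frobNorm (ConePreserving.avg Z k
            - ConePreserving.blockMat A γ (ConePreserving.avg L k) (ConePreserving.avg S k)
                (ConePreserving.avg μ k)) ≤ C / k) ∧
      (∀ k : ℕ, 1 ≤ k → ∀ Z' L' S' μ' Y', Z'.PosSemidef → (∀ i j, 0 ≤ μ' i j) →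
        ConePreserving.lagrangian A γ lam (ConePreserving.avg Z k) (ConePreserving.avg L k)
            (ConePreserving.avg S k) (ConePreserving.avg μ k) Y'
          - ConePreserving.lagrangian A γ lam Z' L' S' μ'
              (ConePreserving.avgPredictedY A γ ρ Z L S μ Y k)
        ≤ (ρ / τ * (ConePreserving.frobNorm (L' - L 0) ^ 2
                + ConePreserving.frobNorm (S' - S 0) ^ 2
                + ConePreserving.frobNorm (μ' - μ 0) ^ 2)
              + 1 / ρ * ConePreserving.frobNorm (Y' - Y 0) ^ 2) / (2 * k))) := by
  have hτ4 : τ < 1 / 4 := hτ'.trans_eq (by norm_num)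
  refine ⟨fun hm hn => ConePreserving.isLUB_frobNorm_opG hm hn,
    fun Z₀ L₀ S₀ μ₀ Y₀ hμ₀ hY₀ =>
      ConePreserving.exists_isLADMM A γ lam ρ τ Z₀ L₀ S₀ μ₀ Y₀ hμ₀ hY₀,
    fun Z L S μ Y h => ⟨?_, fun k hk Z' L' S' μ' Y' hZ' hμ' => ?_⟩⟩
  · exact h.exists_optimal_limit hγ hlam hρ hτ hτ4 hA
  · exact h.lagrangian_gap_le hlam.le hρ hτ hτ4.le (Nat.one_le_iff_ne_zero.1 hk) L' S' Y' hZ' hμ'
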